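/- A hypergraph $H=(V,E)$ consists of a finite nonempty vertex set $V$ and a set $E$ of subsets of $V$ (hyperedges) such that every vertex belongs to some hyperedge. Its dimension is $\max_{e\in E}|e|$, and its maximum degree $\Delta$ is the largest number of hyperedges containing a common vertex. A transversal of $H$ is a set of vertices meeting every hyperedge, and the dual $H^d$ has vertex set $V$ and, as hyperedges, exactly the inclusion-minimal transversals of $H$. $H$ is dually conformal if $H^d$ is conformal, that is, if every set $U\subseteq V$, each pair of distinct elements of which lies in a common hyperedge of $H^d$, is contained in a hyperedge of $H^d$. Theorem. For every fixed positive integer $k$ there is an algorithm that, given a hypergraph $H=(V,E)$ with dimension at most $k$ and maximum degree $\Delta$, decides whether $H$ is dually conformal in time $$O\big(|E|\,|V|^2\Delta^2+|E|\,|V|^k\big),$$ where the implied constant depends only on $k$. Here $H$ is given by the complete list of its hyperedges, each as a list of vertices, with respect to some ordering of the vertices and of the hyperedges. Time is counted as the number of steps of a random access machine (comparisons, addition, subtraction, multiplication, indirect addressing) whose words have $O(\log(|V|+|E|))$ bits, with a constant depending only on $k$. -/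

import Mathlib

universe u

/-! ## Transversals, dual hypergraphs, conformality -/

namespace Hypergraph

variable {α : Type u}

/-- A transversal of `H`: a set of vertices that meets every hyperedge. -/
def IsTransversal (H : Hypergraph α) (T : Set α) : Prop :=
  T ⊆ H.vertexSet ∧ ∀ e ∈ H.edgeSet, (T ∩ e).Nonempty

/-- A transversal of `H` that contains no other transversal of `H`. -/
def IsMinimalTransversal (H : Hypergraph α) (T : Set α) : Prop :=
  H.IsTransversal T ∧ ∀ T', H.IsTransversal T' → T' ⊆ T → T' = T

/-- The dual hypergraph `H^d`: same vertex set, and the hyperedges are exactly the minimal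
transversals of `H`. -/
def dual (H : Hypergraph α) : Hypergraph α where
  vertexSet := H.vertexSet
  edgeSet := {T | H.IsMinimalTransversal T}
  subset_vertexSet_of_mem_edgeSet' := fun _ hT => hT.1.1

/-- `H` is conformal if every set `U` of vertices, each pair of (distinct) elements of which is
contained in some hyperedge, is itself contained in some hyperedge. -/
def IsConformal (H : Hypergraph α) : Prop :=
  ∀ U ⊆ H.vertexSet,
    (∀ x ∈ U, ∀ y ∈ U, x ≠ y → ∃ e ∈ H.edgeSet, x ∈ e ∧ y ∈ e) →
      ∃ e ∈ H.edgeSet, U ⊆ e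

/-- `H` is dually conformal if its dual hypergraph is conformal. -/
def IsDuallyConformal (H : Hypergraph α) : Prop :=
  H.dual.IsConformal

/-- The dimension: the maximum size of a hyperedge (of a finite hypergraph). -/
noncomputable def dimension (H : Hypergraph α) : ℕ :=
  sSup (Set.ncard '' H.edgeSet)

/-- The degree of a vertex: the number of hyperedges that contain it. -/
noncomputable def degree (H : Hypergraph α) (v : α) : ℕ :=
  {e ∈ H.edgeSet | v ∈ e}.ncard

/-- The maximum degree of a vertex (of a finite hypergraph). -/
noncomputable def maxDegree (H : Hypergraph α) : ℕ :=
  sSup (H.degree '' H.vertexSet)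

/-- A representation of a (finite) hypergraph `H` as an input of an algorithm: an ordering of its
vertices, and a complete list of its hyperedges, in some order and without repetition, each of
them given by a list of (the numbers of) its vertices, in some order and without repetition. -/
structure Listing (H : Hypergraph α) where
  /-- the number of vertices -/
  n : ℕ
  /-- the ordering of the vertices -/
  vertex : Fin n → α
  vertex_injective : Function.Injective vertex
  range_vertex : Set.range vertex = H.vertexSet
  /-- the list of the hyperedges -/
  edges : List (List (Fin n))
  nodup_of_mem : ∀ l ∈ edges, l.Nodup
  edges_distinct : edges.Pairwise fun l l' => {i | i ∈ l} ≠ {i | i ∈ l'}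
  edgeSet_eq : H.edgeSet = {e | ∃ l ∈ edges, e = vertex '' {i | i ∈ l}}

/-- The sequence of numbers by which a listing is handed to a machine: the number of vertices, the
number of hyperedges, and then, for each hyperedge, its size followed by the numbers
(in `{0, …, n - 1}`) of its vertices. -/
def Listing.encode {H : Hypergraph α} (R : H.Listing) : List ℕ :=
  R.n :: R.edges.length :: R.edges.flatMap fun l => l.length :: l.map fun i => (i : ℕ)

end Hypergraph

/-! ## A random access machine with a step count

The machine has registers `r₀, r₁, …`, of which a program uses only finitely many, and a memory,
an array of cells with addresses `0, 1, 2, …`, accessed by indirect addressing. Registers and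
cells hold words, that is, natural numbers below a bound `W`. -/

namespace RAM

/-- The tests: they compare two registers. -/
inductive Test : Type
  | lt (x y : ℕ)
  | eq (x y : ℕ)
  | ne (x y : ℕ)

/-- Programs, in structured form. The arguments `x y z` are numbers of registers. -/
inductive Program : Type
  /-- do nothing -/
  | skip
  /-- `r_x := c` -/
  | const (x c : ℕ)
  /-- `r_x := r_y` -/
  | copy (x y : ℕ)
  /-- `r_x := r_y + r_z` -/
  | add (x y z : ℕ)
  /-- `r_x := max (r_y - r_z) 0` -/
  | sub (x y z : ℕ)
  /-- `r_x := r_y * r_z` -/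
  | mul (x y z : ℕ)
  /-- `r_x := memory[r_y]` -/
  | load (x y : ℕ)
  /-- `memory[r_x] := r_y` -/
  | store (x y : ℕ)
  /-- run `P`, then `Q` -/
  | seq (P Q : Program)
  /-- if `b` then `P` else `Q` -/
  | ite (b : Test) (P Q : Program)
  /-- while `b` do `P` -/
  | while (b : Test) (P : Program)

/-- The contents of the registers and of the memory. -/
structure State : Type where
  reg : ℕ → ℕ
  mem : ℕ → ℕ

/-- Assign the value `a` to the register `x`. -/
def State.setReg (s : State) (x a : ℕ) : State :=
  { s with reg := Function.update s.reg x a }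

/-- Write the value `a` into the memory cell with address `i`. -/
def State.setMem (s : State) (i a : ℕ) : State :=
  { s with mem := Function.update s.mem i a }

/-- The initial state on an input: it stands in the first memory cells, everything else is `0`. -/
def State.init (input : List ℕ) : State where
  reg := fun _ => 0
  mem := fun i => input.getD i 0

/-- The truth value of a test. -/
def Test.Holds (s : State) : Test → Prop
  | .lt x y => s.reg x < s.reg y
  | .eq x y => s.reg x = s.reg y
  | .ne x y => s.reg x ≠ s.reg y

/-- `Exec W P s s' t`: the program `P`, started in the state `s` on a machine whose words are the
numbers below `W`, halts in the state `s'` after exactly `t` steps, without overflow. Each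
elementary instruction and each evaluation of a test is one step. An instruction whose result
would not be a word has no execution. -/
inductive Exec (W : ℕ) : Program → State → State → ℕ → Prop
  | skip (s : State) : Exec W .skip s s 1
  | const (s : State) (x c : ℕ) (h : c < W) : Exec W (.const x c) s (s.setReg x c) 1
  | copy (s : State) (x y : ℕ) : Exec W (.copy x y) s (s.setReg x (s.reg y)) 1
  | add (s : State) (x y z : ℕ) (h : s.reg y + s.reg z < W) :
      Exec W (.add x y z) s (s.setReg x (s.reg y + s.reg z)) 1
  | sub (s : State) (x y z : ℕ) : Exec W (.sub x y z) s (s.setReg x (s.reg y - s.reg z)) 1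
  | mul (s : State) (x y z : ℕ) (h : s.reg y * s.reg z < W) :
      Exec W (.mul x y z) s (s.setReg x (s.reg y * s.reg z)) 1
  | load (s : State) (x y : ℕ) : Exec W (.load x y) s (s.setReg x (s.mem (s.reg y))) 1
  | store (s : State) (x y : ℕ) : Exec W (.store x y) s (s.setMem (s.reg x) (s.reg y)) 1
  | seq {P Q : Program} {s s' s'' : State} {t t' : ℕ} (h : Exec W P s s' t)
      (h' : Exec W Q s' s'' t') : Exec W (.seq P Q) s s'' (t + t')
  | ite_true {b : Test} {P Q : Program} {s s' : State} {t : ℕ} (hb : b.Holds s)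
      (h : Exec W P s s' t) : Exec W (.ite b P Q) s s' (t + 1)
  | ite_false {b : Test} {P Q : Program} {s s' : State} {t : ℕ} (hb : ¬ b.Holds s)
      (h : Exec W Q s s' t) : Exec W (.ite b P Q) s s' (t + 1)
  | while_true {b : Test} {P : Program} {s s' s'' : State} {t t' : ℕ} (hb : b.Holds s)
      (h : Exec W P s s' t) (h' : Exec W (.while b P) s' s'' t') :
      Exec W (.while b P) s s'' (t + t' + 1)
  | while_false {b : Test} {P : Program} {s : State} (hb : ¬ b.Holds s) :
      Exec W (.while b P) s s 1

/-- On a machine whose words are the numbers below `W`, all entries of the input are words, and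
the program `P` halts on it after at most `T` steps with the answer to the question `q` in the
register `r₀` (`1` for yes and `0` for no). -/
def Answers (W : ℕ) (P : Program) (input : List ℕ) (T : ℕ) (q : Prop) : Prop :=
  (∀ a ∈ input, a < W) ∧
    ∃ (s : State) (t : ℕ), Exec W P (State.init input) s t ∧ t ≤ T ∧
      (q → s.reg 0 = 1) ∧ (¬ q → s.reg 0 = 0)

end RAM

/-! Let G be the graph on V joining two distinct vertices that lie in a common minimal transversal.
Conformality of the dual says that every clique of G lies in a minimal transversal. This holds iff
every maximal clique is a transversal and no neighbourhood N(v) is one (`isDuallyConformal_iff`). If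
T is a minimal transversal inside N(v), then T ∪ {v} is a clique contained in no minimal
transversal. Conversely, if D is a maximal clique, T ⊆ D a minimal transversal and v ∈ D \ T, then T
⊆ N(v).

Both conditions are cheap to test. A maximal clique misses an edge e exactly when some clique
contains, for each x ∈ e, a vertex other than x and not adjacent to x. One such vertex per element
of e suffices, so only n^k tuples need be tried for each of the m edges
(`Listing.exists_clique_iff`, `Dec.obstructed`). The neighbourhood test takes O(nm) steps. Adjacency
of u and v is witnessed by a private edge e of u and a private edge f of v, provided that no edge
lies inside (e \ {u}) ∪ (f \ {v}) (`dualAdj_iff`). There are at most Δ² such pairs of edges and each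
check takes O(m) steps, so the matrix of G is filled in O(m n² Δ²) steps (`Dec.dualAdj`,
`Acts.fill`).

The machine part is a small compositional calculus: `Val`, `Dec` and `Acts` bundle correctness,
absence of overflow and a step bound of a code fragment, with one rule for each construct. -/

namespace Hypergraph

/-! ### Minimal transversals and the co-occurrence graph of the dual -/

variable {α : Type u} {H : Hypergraph α}

/-- Two distinct vertices are co-occurring in the dual if they lie in a common minimal
transversal. -/
def DualAdj (H : Hypergraph α) (u v : α) : Prop :=
  u ≠ v ∧ ∃ T, H.IsMinimalTransversal T ∧ u ∈ T ∧ v ∈ T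

lemma DualAdj.symm {u v : α} (h : H.DualAdj u v) : H.DualAdj v u :=
  let ⟨hne, T, hT, hu, hv⟩ := h
  ⟨hne.symm, T, hT, hv, hu⟩

lemma IsTransversal.exists_minimal_subset (hV : H.vertexSet.Finite) {T : Set α}
    (hT : H.IsTransversal T) : ∃ T' ⊆ T, H.IsMinimalTransversal T' := by
  have hfin : {T' | H.IsTransversal T'}.Finite :=
    hV.finite_subsets.subset fun T' hT' => hT'.1
  obtain ⟨T', hle, hmin⟩ := hfin.exists_le_minimal hT
  exact ⟨T', hle, hmin.1, fun T'' h h' => h'.antisymm (hmin.2 h h')⟩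

/-- If every edge through u met T in a further vertex, T \ {u} would still be a transversal. -/
lemma IsMinimalTransversal.exists_private {T : Set α} (hT : H.IsMinimalTransversal T) {u : α}
    (hu : u ∈ T) : ∃ e ∈ H.edgeSet, u ∈ e ∧ ∀ x ∈ T, x ∈ e → x = u := by
  by_contra! hcon
  have : H.IsTransversal (T \ {u}) := by
    refine ⟨Set.sdiff_subset.trans hT.1.1, fun e he => ?_⟩
    by_cases hue : u ∈ e
    · obtain ⟨x, hx, hxe, hxu⟩ := hcon e he hue
      exact ⟨x, ⟨hx, hxu⟩, hxe⟩
    · obtain ⟨x, hx, hxe⟩ := hT.1.2 e he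
      exact ⟨x, ⟨hx, fun h => hue (h ▸ hxe)⟩, hxe⟩
  have h := hT.2 _ this Set.sdiff_subset
  rw [← h] at hu
  exact hu.2 rfl

/-- Private edges e of u and f of v force T to avoid (e \ {u}) ∪ (f \ {v}). Conversely, when the
complement of this set is a transversal, any minimal transversal inside it can meet e only in u and
f only in v, hence contains both. -/
lemma dualAdj_iff (hV : H.vertexSet.Finite) {u v : α} :
    H.DualAdj u v ↔ ∃ e ∈ H.edgeSet, (u ∈ e ∧ v ∉ e) ∧ ∃ f ∈ H.edgeSet, (v ∈ f ∧ u ∉ f) ∧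
      ∀ g ∈ H.edgeSet, ∃ x ∈ g, ¬ (x ∈ e ∧ x ≠ u) ∧ ¬ (x ∈ f ∧ x ≠ v) := by
  constructor
  · rintro ⟨hne, T, hT, hu, hv⟩
    obtain ⟨e, he, hue, he'⟩ := hT.exists_private hu
    obtain ⟨f, hf, hvf, hf'⟩ := hT.exists_private hv
    refine ⟨e, he, ⟨hue, fun h => hne (he' v hv h).symm⟩, f, hf,
      ⟨hvf, fun h => hne (hf' u hu h)⟩, fun g hg => ?_⟩
    obtain ⟨x, hx, hxg⟩ := hT.1.2 g hg
    exact ⟨x, hxg, fun h => h.2 (he' x hx h.1), fun h => h.2 (hf' x hx h.1)⟩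
  · rintro ⟨e, he, ⟨hue, hve⟩, f, hf, ⟨hvf, huf⟩, h⟩
    have hT : H.IsTransversal
        {x | x ∈ H.vertexSet ∧ ¬ (x ∈ e ∧ x ≠ u) ∧ ¬ (x ∈ f ∧ x ≠ v)} := by
      refine ⟨fun x hx => hx.1, fun g hg => ?_⟩
      obtain ⟨x, hx, hx'⟩ := h g hg
      exact ⟨x, ⟨H.subset_vertexSet_of_mem_edgeSet' hg hx, hx'⟩, hx⟩
    obtain ⟨T, hTs, hTm⟩ := hT.exists_minimal_subset hV
    refine ⟨fun h => hve (h ▸ hue), T, hTm, ?_, ?_⟩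
    · obtain ⟨x, hx, hxe⟩ := hTm.1.2 e he
      obtain rfl : x = u := by_contra fun hxu => (hTs hx).2.1 ⟨hxe, hxu⟩
      exact hx
    · obtain ⟨x, hx, hxf⟩ := hTm.1.2 f hf
      obtain rfl : x = v := by_contra fun hxv => (hTs hx).2.2 ⟨hxf, hxv⟩
      exact hx

/-- Dual conformality in terms of the co-occurrence graph of the dual: no clique of the graph
obstructs an edge, and no neighbourhood is a transversal. -/
lemma isDuallyConformal_iff (hV : H.vertexSet.Finite) :
    H.IsDuallyConformal ↔
      (∀ e ∈ H.edgeSet, ¬ ∃ D ⊆ H.vertexSet, (∀ x ∈ D, ∀ y ∈ D, x ≠ y → H.DualAdj x y) ∧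
        ∀ x ∈ e, ∃ y ∈ D, y ≠ x ∧ ¬ H.DualAdj x y) ∧
      ∀ v ∈ H.vertexSet, ∃ e ∈ H.edgeSet, ∀ x ∈ e, ¬ H.DualAdj x v := by
  constructor
  · intro h
    have key : ∀ D ⊆ H.vertexSet, (∀ x ∈ D, ∀ y ∈ D, x ≠ y → H.DualAdj x y) →
        ∃ T, H.IsMinimalTransversal T ∧ D ⊆ T := fun D hD hclq =>
      h D hD fun x hx y hy hxy => (hclq x hx y hy hxy).2
    constructor
    · rintro e he ⟨D, hD, hclq, hobs⟩
      obtain ⟨T, hT, hDT⟩ := key D hD hclq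
      -- T is itself a clique, so its point x in e is equal or adjacent to every member of D.
      obtain ⟨x, hx, hxe⟩ := hT.1.2 e he
      obtain ⟨y, hy, hyx, hadj⟩ := hobs x hxe
      exact hadj ⟨hyx.symm, T, hT, hx, hDT hy⟩
    · intro v hv
      by_contra! hcon
      have hN : H.IsTransversal {x | x ∈ H.vertexSet ∧ H.DualAdj x v} := by
        refine ⟨fun x hx => hx.1, fun e he => ?_⟩
        obtain ⟨x, hx, hxv⟩ := hcon e he
        exact ⟨x, ⟨H.subset_vertexSet_of_mem_edgeSet' he hx, hxv⟩, hx⟩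
      obtain ⟨T, hTN, hT⟩ := hN.exists_minimal_subset hV
      -- T lies in the neighbourhood of v, so adding v keeps it a clique; minimality of T' then
      -- gives T = T' and v would be its own neighbour.
      obtain ⟨T', hT', hsub⟩ := key (insert v T)
        (Set.insert_subset hv hT.1.1) (by
          rintro x (rfl | hx) y (rfl | hy) hxy
          · exact absurd rfl hxy
          · exact (hTN hy).2.symm
          · exact (hTN hx).2
          · exact ⟨hxy, T, hT, hx, hy⟩)
      have hTT' := hT'.2 T hT.1 ((Set.subset_insert v T).trans hsub)
      have hvT : v ∈ T := hTT' ▸ hsub (Set.mem_insert v T)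
      exact (hTN hvT).2.1 rfl
  · rintro ⟨h1, h2⟩ U hU hpair
    have hfin : {D | D ⊆ H.vertexSet ∧ ∀ x ∈ D, ∀ y ∈ D, x ≠ y → H.DualAdj x y}.Finite :=
      hV.finite_subsets.subset fun D hD => hD.1
    obtain ⟨D, hUD, ⟨hD, hclq⟩, hmax⟩ := hfin.exists_le_maximal
      ⟨hU, fun x hx y hy hxy => ⟨hxy, hpair x hx y hy hxy⟩⟩
    have htr : H.IsTransversal D := by
      refine ⟨hD, fun e he => ?_⟩
      by_contra hemp
      refine h1 e he ⟨D, hD, hclq, fun x hx => ?_⟩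
      by_contra! hcon
      -- An x in e that is adjacent to all other members of D could be added to the maximal clique
      -- D.
      have hxD : x ∈ D := hmax (y := insert x D)
        ⟨Set.insert_subset (H.subset_vertexSet_of_mem_edgeSet' he hx) hD, by
          rintro y (rfl | hy) z (rfl | hz) hyz
          · exact absurd rfl hyz
          · exact hcon z hz hyz.symm
          · exact (hcon y hy hyz).symm
          · exact hclq y hy z hz hyz⟩ (Set.subset_insert x D) (Set.mem_insert x D)
      exact hemp ⟨x, hxD, hx⟩
    obtain ⟨T, hTD, hT⟩ := htr.exists_minimal_subset hV
    refine ⟨T, hT, hUD.trans fun v hv => ?_⟩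
    by_contra hvT
    -- If v ∈ D \ T, all of T is adjacent to v, yet T must meet the edge e that avoids the
    -- neighbours of v.
    obtain ⟨e, he, hev⟩ := h2 v (hD hv)
    obtain ⟨x, hx, hxe⟩ := hT.1.2 e he
    exact hev x hxe (hclq x (hTD hx) v hv fun h => hvT (h ▸ hx))

end Hypergraph

namespace RAM

/-! ### Machine states with named variables and scratch registers; step-bounded runs -/

open Finset Function

/-- The state in which the registers with even numbers hold the values `ρ` of variables, those
with odd numbers the scratch values `σ`, and the memory is `M`. -/
def State.of (ρ σ M : ℕ → ℕ) : State where
  reg i := if i % 2 = 0 then ρ (i / 2) else σ (i / 2)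
  mem := M

section
variable (ρ σ M : ℕ → ℕ) (x a : ℕ)

@[simp] lemma State.of_reg_even : (State.of ρ σ M).reg (2 * x) = ρ x := by
  simp [State.of]

@[simp] lemma State.of_reg_odd : (State.of ρ σ M).reg (2 * x + 1) = σ x := by
  have h1 : (2 * x + 1) % 2 = 1 := by omega
  have h2 : (2 * x + 1) / 2 = x := by omega
  simp [State.of, h1, h2]

@[simp] lemma State.of_mem : (State.of ρ σ M).mem = M := rfl

@[simp] lemma State.of_setReg_even :
    (State.of ρ σ M).setReg (2 * x) a = State.of (update ρ x a) σ M := by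
  simp only [State.of, State.setReg, State.mk.injEq, and_true]
  funext i
  simp only [update_apply]
  split_ifs <;> first | rfl | omega

@[simp] lemma State.of_setReg_odd :
    (State.of ρ σ M).setReg (2 * x + 1) a = State.of ρ (update σ x a) M := by
  simp only [State.of, State.setReg, State.mk.injEq, and_true]
  funext i
  simp only [update_apply]
  split_ifs <;> first | rfl | omega

@[simp] lemma State.of_setMem :
    (State.of ρ σ M).setMem x a = State.of ρ σ (update M x a) := rfl

end

/-- `P` leads from `s` to `s'` in at most `c` steps. -/
def Runs (W : ℕ) (P : Program) (s s' : State) (c : ℕ) : Prop :=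
  ∃ t ≤ c, Exec W P s s' t

section
variable {W : ℕ} {P Q : Program} {s s' s'' : State} {c c' : ℕ}

lemma Exec.runs {t : ℕ} (h : Exec W P s s' t) : Runs W P s s' t := ⟨t, le_rfl, h⟩

lemma Runs.mono (h : Runs W P s s' c) (hc : c ≤ c') : Runs W P s s' c' :=
  let ⟨t, ht, h⟩ := h
  ⟨t, ht.trans hc, h⟩

lemma Runs.seq (h : Runs W P s s' c) (h' : Runs W Q s' s'' c') :
    Runs W (.seq P Q) s s'' (c + c') :=
  let ⟨_, ht, h⟩ := h
  let ⟨_, ht', h'⟩ := h'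
  ⟨_, add_le_add ht ht', .seq h h'⟩

lemma Runs.ite_true {b : Test} (hb : b.Holds s) (h : Runs W P s s' c) :
    Runs W (.ite b P Q) s s' (c + 1) :=
  let ⟨_, ht, h⟩ := h
  ⟨_, Nat.succ_le_succ ht, .ite_true hb h⟩

lemma Runs.ite_false {b : Test} (hb : ¬ b.Holds s) (h : Runs W Q s s' c) :
    Runs W (.ite b P Q) s s' (c + 1) :=
  let ⟨_, ht, h⟩ := h
  ⟨_, Nat.succ_le_succ ht, .ite_false hb h⟩

lemma Runs.while_true {b : Test} (hb : b.Holds s) (h : Runs W P s s' c)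
    (h' : Runs W (.while b P) s' s'' c') : Runs W (.while b P) s s'' (c + c' + 1) :=
  let ⟨_, ht, h⟩ := h
  let ⟨_, ht', h'⟩ := h'
  ⟨_, Nat.succ_le_succ (add_le_add ht ht'), .while_true hb h h'⟩

end

section
variable {W : ℕ} (ρ σ M : ℕ → ℕ)

lemma runs_const_odd {x c : ℕ} (h : c < W) :
    Runs W (.const (2 * x + 1) c) (.of ρ σ M) (.of ρ (update σ x c) M) 1 := by
  simpa using (Exec.const (State.of ρ σ M) (2 * x + 1) c h).runs

lemma runs_copy_odd_even (x y : ℕ) :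
    Runs W (.copy (2 * x + 1) (2 * y)) (.of ρ σ M) (.of ρ (update σ x (ρ y)) M) 1 := by
  simpa using (Exec.copy (W := W) (State.of ρ σ M) (2 * x + 1) (2 * y)).runs

lemma runs_copy_odd_odd (x y : ℕ) :
    Runs W (.copy (2 * x + 1) (2 * y + 1)) (.of ρ σ M) (.of ρ (update σ x (σ y)) M) 1 := by
  simpa using (Exec.copy (W := W) (State.of ρ σ M) (2 * x + 1) (2 * y + 1)).runs

lemma runs_copy_even_odd (x y : ℕ) :
    Runs W (.copy (2 * x) (2 * y + 1)) (.of ρ σ M) (.of (update ρ x (σ y)) σ M) 1 := by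
  simpa using (Exec.copy (W := W) (State.of ρ σ M) (2 * x) (2 * y + 1)).runs

lemma runs_add_odd {x y z : ℕ} (h : σ y + σ z < W) :
    Runs W (.add (2 * x + 1) (2 * y + 1) (2 * z + 1)) (.of ρ σ M)
      (.of ρ (update σ x (σ y + σ z)) M) 1 := by
  simpa using (Exec.add (W := W) (State.of ρ σ M) (2 * x + 1) (2 * y + 1) (2 * z + 1)
    (by simpa using h)).runs

lemma runs_mul_odd {x y z : ℕ} (h : σ y * σ z < W) :
    Runs W (.mul (2 * x + 1) (2 * y + 1) (2 * z + 1)) (.of ρ σ M)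
      (.of ρ (update σ x (σ y * σ z)) M) 1 := by
  simpa using (Exec.mul (W := W) (State.of ρ σ M) (2 * x + 1) (2 * y + 1) (2 * z + 1)
    (by simpa using h)).runs

lemma runs_load_odd (x y : ℕ) :
    Runs W (.load (2 * x + 1) (2 * y + 1)) (.of ρ σ M) (.of ρ (update σ x (M (σ y))) M) 1 := by
  simpa using (Exec.load (W := W) (State.of ρ σ M) (2 * x + 1) (2 * y + 1)).runs

lemma runs_store_odd (x y : ℕ) :
    Runs W (.store (2 * x + 1) (2 * y + 1)) (.of ρ σ M) (.of ρ σ (update M (σ x) (σ y))) 1 := by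
  simpa using (Exec.store (W := W) (State.of ρ σ M) (2 * x + 1) (2 * y + 1)).runs

end

/-- A counting loop: `N` is in scratch register `d`, the counter in scratch register `d + 1`. -/
lemma runs_while_count {W N d : ℕ} {P : Program} {c : ℕ → ℕ}
    (I : ℕ → (ℕ → ℕ) → (ℕ → ℕ) → (ℕ → ℕ) → Prop)
    (hstep : ∀ i < N, ∀ ρ σ M, I i ρ σ M → σ d = N → σ (d + 1) = i →
      ∃ ρ' σ' M', Runs W P (.of ρ σ M) (.of ρ' σ' M') (c i) ∧ σ' d = N ∧ σ' (d + 1) = i + 1 ∧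
        I (i + 1) ρ' σ' M')
    {ρ σ M : ℕ → ℕ} (h0 : I 0 ρ σ M) (hN : σ d = N) (hi : σ (d + 1) = 0) :
    ∃ ρ' σ' M', Runs W (.while (.lt (2 * (d + 1) + 1) (2 * d + 1)) P) (.of ρ σ M) (.of ρ' σ' M')
      (∑ i ∈ range N, (c i + 1) + 1) ∧ I N ρ' σ' M' := by
  -- Induction on the number r of remaining rounds.
  suffices H : ∀ r i, r + i = N → ∀ ρ σ M, I i ρ σ M → σ d = N → σ (d + 1) = i →
      ∃ ρ' σ' M', Runs W (.while (.lt (2 * (d + 1) + 1) (2 * d + 1)) P) (.of ρ σ M)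
        (.of ρ' σ' M') (∑ j ∈ Ico i N, (c j + 1) + 1) ∧ I N ρ' σ' M' by
    simpa using H N 0 rfl ρ σ M h0 hN hi
  intro r
  induction r with
  | zero =>
    intro i hi ρ σ M hI h1 h2
    obtain rfl : i = N := by omega
    refine ⟨ρ, σ, M, ?_, hI⟩
    have : ¬ (Test.lt (2 * (d + 1) + 1) (2 * d + 1)).Holds (State.of ρ σ M) := by
      simp only [Test.Holds, State.of_reg_odd]; omega
    exact (Exec.while_false this).runs.mono (by simp)
  | succ r ih =>
    intro i hi ρ σ M hI h1 h2
    obtain ⟨ρ₁, σ₁, M₁, hr, h3, h4, h5⟩ := hstep i (by omega) ρ σ M hI h1 h2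
    obtain ⟨ρ₂, σ₂, M₂, hr', h6⟩ := ih (i + 1) (by omega) ρ₁ σ₁ M₁ h5 h3 h4
    refine ⟨ρ₂, σ₂, M₂, ?_, h6⟩
    have : (Test.lt (2 * (d + 1) + 1) (2 * d + 1)).Holds (State.of ρ σ M) := by
      simp only [Test.Holds, State.of_reg_odd]; omega
    refine (Runs.while_true this hr hr').mono ?_
    rw [Finset.sum_eq_sum_Ico_succ_bot (by omega : i < N)]
    omega

/-! ### Expressions and formulas, evaluated with the scratch registers as a stack -/

/-- Program text with a parameter `d`, which tells it to use only scratch registers from number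
`d` on. -/
abbrev Code : Type := ℕ → Program

/-- With variables `ρ` and memory `M`, the code `T` computes the value `v` in at most `c` steps. -/
def Val (W : ℕ) (T : Code) (ρ M : ℕ → ℕ) (v c : ℕ) : Prop :=
  ∀ d σ, ∃ σ', (∀ j < d, σ' j = σ j) ∧ σ' d = v ∧ Runs W (T d) (.of ρ σ M) (.of ρ σ' M) c

open Classical in
/-- With variables `ρ` and memory `M`, the code `T` computes the truth value of `p` in at most `c`
steps. -/
def Dec (W : ℕ) (T : Code) (ρ M : ℕ → ℕ) (p : Prop) (c : ℕ) : Prop :=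
  Val W T ρ M (if p then 1 else 0) c

namespace Code

/-- the value of a variable -/
def var (x : ℕ) : Code := fun d => .copy (2 * d + 1) (2 * x)

/-- a constant -/
def lit (c : ℕ) : Code := fun d => .const (2 * d + 1) c

/-- the content of the memory cell with a computed address -/
def fetch (T : Code) : Code := fun d => .seq (T d) (.load (2 * d + 1) (2 * d + 1))

/-- a sum -/
def plus (T U : Code) : Code := fun d =>
  .seq (T d) (.seq (U (d + 1)) (.add (2 * d + 1) (2 * d + 1) (2 * (d + 1) + 1)))

/-- a product -/
def times (T U : Code) : Code := fun d =>
  .seq (T d) (.seq (U (d + 1)) (.mul (2 * d + 1) (2 * d + 1) (2 * (d + 1) + 1)))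

/-- the truth value of an equation -/
def equal (T U : Code) : Code := fun d =>
  .seq (T d) (.seq (U (d + 1)) (.ite (.eq (2 * d + 1) (2 * (d + 1) + 1))
    (.const (2 * d + 1) 1) (.const (2 * d + 1) 0)))

/-- negation -/
def neg (T : Code) : Code := equal T (lit 0)

/-- conjunction; the second formula is evaluated only if the first one is true -/
def conj (T U : Code) : Code := fun d =>
  .seq (T d) (.seq (.const (2 * (d + 1) + 1) 0) (.ite (.eq (2 * d + 1) (2 * (d + 1) + 1))
    .skip (U d)))

/-- disjunction; the second formula is evaluated only if the first one is false -/
def disj (T U : Code) : Code := neg (conj (neg T) (neg U))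

/-- existential quantification over a sequence of `N` numbers, of which `A` is the first one, and
`S` computes each number from the preceding one `x` -/
def exist (x : ℕ) (A N S T : Code) : Code := fun d =>
  .seq (.copy (2 * d + 1) (2 * x)) <| .seq (N (d + 1)) <| .seq (A (d + 2)) <|
  .seq (.copy (2 * x) (2 * (d + 2) + 1)) <| .seq (.const (2 * (d + 2) + 1) 0) <|
  .seq (.const (2 * (d + 3) + 1) 0) <|
  .seq (.while (.lt (2 * (d + 2) + 1) (2 * (d + 1) + 1)) <|
    .seq (T (d + 4)) <| .seq (.const (2 * (d + 5) + 1) 0) <|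
    .seq (.ite (.eq (2 * (d + 4) + 1) (2 * (d + 5) + 1)) .skip (.const (2 * (d + 3) + 1) 1)) <|
    .seq (S (d + 4)) <| .seq (.copy (2 * x) (2 * (d + 4) + 1)) <|
    .seq (.const (2 * (d + 4) + 1) 1) <|
    .add (2 * (d + 2) + 1) (2 * (d + 2) + 1) (2 * (d + 4) + 1)) <|
  .seq (.copy (2 * x) (2 * d + 1)) <| .copy (2 * d + 1) (2 * (d + 3) + 1)

end Code

section
variable {W : ℕ} {ρ M : ℕ → ℕ} {T U : Code} {v w c c' : ℕ} {p q : Prop}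

lemma Val.mono (h : Val W T ρ M v c) (hc : c ≤ c') : Val W T ρ M v c' := fun d σ =>
  let ⟨σ', h1, h2, h3⟩ := h d σ
  ⟨σ', h1, h2, h3.mono hc⟩

lemma Val.var (x : ℕ) : Val W (.var x) ρ M (ρ x) 1 := fun d σ =>
  ⟨_, fun j hj => by simp [hj.ne], by simp, runs_copy_odd_even ρ σ M d x⟩

lemma Val.lit (h : v < W) : Val W (.lit v) ρ M v 1 := fun d σ =>
  ⟨_, fun j hj => by simp [hj.ne], by simp, runs_const_odd ρ σ M h⟩

lemma Val.fetch (h : Val W T ρ M v c) : Val W (.fetch T) ρ M (M v) (c + 1) := fun d σ =>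
  let ⟨σ', h1, h2, h3⟩ := h d σ
  ⟨_, fun j hj => by simp [hj.ne, h1 j hj], by simp [h2], h3.seq (runs_load_odd ρ σ' M d d)⟩

lemma Val.plus (h : Val W T ρ M v c) (h' : Val W U ρ M w c') (hW : v + w < W) :
    Val W (.plus T U) ρ M (v + w) (c + c' + 1) := fun d σ => by
  obtain ⟨σ₁, h1, h2, h3⟩ := h d σ
  obtain ⟨σ₂, h4, h5, h6⟩ := h' (d + 1) σ₁
  have h7 : σ₂ d = v := by rw [h4 d (by omega), h2]
  exact ⟨_, fun j hj => by simp [hj.ne, h1 j hj, h4 j (by omega)], by simp [h7, h5],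
    (h3.seq (h6.seq (runs_add_odd ρ σ₂ M (x := d) (by rw [h7, h5]; exact hW)))).mono (by omega)⟩

lemma Val.times (h : Val W T ρ M v c) (h' : Val W U ρ M w c') (hW : v * w < W) :
    Val W (.times T U) ρ M (v * w) (c + c' + 1) := fun d σ => by
  obtain ⟨σ₁, h1, h2, h3⟩ := h d σ
  obtain ⟨σ₂, h4, h5, h6⟩ := h' (d + 1) σ₁
  have h7 : σ₂ d = v := by rw [h4 d (by omega), h2]
  exact ⟨_, fun j hj => by simp [hj.ne, h1 j hj, h4 j (by omega)], by simp [h7, h5],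
    (h3.seq (h6.seq (runs_mul_odd ρ σ₂ M (x := d) (by rw [h7, h5]; exact hW)))).mono (by omega)⟩

lemma Dec.mono (h : Dec W T ρ M p c) (hc : c ≤ c') : Dec W T ρ M p c' := Val.mono h hc

lemma Dec.congr (h : Dec W T ρ M p c) (hpq : p ↔ q) : Dec W T ρ M q c := by
  rwa [propext hpq] at h

lemma Dec.equal (hW : 1 < W) (h : Val W T ρ M v c) (h' : Val W U ρ M w c') :
    Dec W (.equal T U) ρ M (v = w) (c + c' + 2) := fun d σ => by
  obtain ⟨σ₁, h1, h2, h3⟩ := h d σ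
  obtain ⟨σ₂, h4, h5, h6⟩ := h' (d + 1) σ₁
  have h7 : σ₂ d = v := by rw [h4 d (by omega), h2]
  by_cases hvw : v = w
  · refine ⟨_, fun j hj => ?_, ?_, (h3.seq (h6.seq (.ite_true ?_
      (runs_const_odd ρ σ₂ M (x := d) hW)))).mono (by omega)⟩
    · simp [hj.ne, h1 j hj, h4 j (by omega)]
    · simp [hvw]
    · simp only [Test.Holds, State.of_reg_odd]; rw [h7, h5, hvw]
  · refine ⟨_, fun j hj => ?_, ?_, (h3.seq (h6.seq (.ite_false ?_
      (runs_const_odd ρ σ₂ M (x := d) (c := 0) (by omega))))).mono (by omega)⟩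
    · simp [hj.ne, h1 j hj, h4 j (by omega)]
    · simp [hvw]
    · simp only [Test.Holds, State.of_reg_odd]; rw [h7, h5]; exact hvw

lemma Dec.neg (hW : 1 < W) (h : Dec W T ρ M p c) : Dec W (.neg T) ρ M (¬ p) (c + 3) := by
  refine ((Dec.equal hW h (Val.lit (by omega))).mono (by omega)).congr ?_
  by_cases hp : p <;> simp [hp]

/-- The cost of the second formula is charged only when the first is true. This is what replaces
factors m by factors Δ in the adjacency test. -/
lemma Dec.conj [Decidable p] (hW : 1 < W) (h : Dec W T ρ M p c) (h' : p → Dec W U ρ M q c') :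
    Dec W (.conj T U) ρ M (p ∧ q) (c + 3 + if p then c' else 0) := fun d σ => by
  obtain ⟨σ₁, h1, h2, h3⟩ := h d σ
  by_cases hp : p
  · obtain ⟨σ₂, h4, h5, h6⟩ := h' hp d (update σ₁ (d + 1) 0)
    refine ⟨σ₂, fun j hj => ?_, ?_, (h3.seq ((runs_const_odd ρ σ₁ M (x := d + 1) (c := 0)
      (by omega)).seq (.ite_false ?_ h6))).mono ?_⟩
    · rw [h4 j hj, ← h1 j hj, update_of_ne (by omega)]
    · by_cases hq : q <;> simp [h5, hp, hq]
    · simp [Test.Holds, h2, hp]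
    · simp only [hp, if_true]; omega
  · refine ⟨_, fun j hj => ?_, ?_, (h3.seq ((runs_const_odd ρ σ₁ M (x := d + 1) (c := 0)
      (by omega)).seq (.ite_true ?_ (Exec.skip _).runs))).mono ?_⟩
    · rw [← h1 j hj, update_of_ne (by omega)]
    · simp [h2, hp]
    · simp [Test.Holds, h2, hp]
    · omega

lemma Dec.conj' (hW : 1 < W) (h : Dec W T ρ M p c) (h' : p → Dec W U ρ M q c') :
    Dec W (.conj T U) ρ M (p ∧ q) (c + c' + 3) := by
  classical
  refine (Dec.conj hW h h').mono ?_
  split_ifs <;> omega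

lemma Dec.disj (hW : 1 < W) (h : Dec W T ρ M p c) (h' : ¬ p → Dec W U ρ M q c') :
    Dec W (.disj T U) ρ M (p ∨ q) (c + c' + 12) :=
  ((Dec.neg hW (Dec.conj' hW (Dec.neg hW h) fun hp => Dec.neg hW (h' hp))).mono (by omega)).congr
    (by tauto)

/-- All N rounds are always carried out, so the costs of the bodies add up. The successor is
computed in the last round too, so `it N` must also be computable without overflow. -/
lemma Dec.exist {x N cA cN cS : ℕ} {A B S : Code} {it c : ℕ → ℕ} {p : ℕ → Prop}
    (hW : 1 < W) (hN : N < W) (hA : Val W A ρ M (it 0) cA) (hB : Val W B ρ M N cN)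
    (hS : ∀ i < N, Val W S (update ρ x (it i)) M (it (i + 1)) cS)
    (hT : ∀ i < N, Dec W T (update ρ x (it i)) M (p i) (c i)) :
    Dec W (.exist x A B S T) ρ M (∃ i < N, p i)
      (∑ i ∈ range N, c i + N * (cS + 7) + (cA + cN + 7)) := fun d σ => by
  classical
  obtain ⟨σ₁, h1, h2, h3⟩ := hB (d + 1) (update σ d (ρ x))
  obtain ⟨σ₂, h4, h5, h6⟩ := hA (d + 2) σ₁
  -- Scratch `d` keeps the old value of `x`, to be restored at the end; `d + 1` holds N, `d + 2` the
  -- counter and `d + 3` the disjunction of the instances seen so far.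
  let I : ℕ → (ℕ → ℕ) → (ℕ → ℕ) → (ℕ → ℕ) → Prop := fun i ρ' σ' M' =>
    ρ' = update ρ x (it i) ∧ M' = M ∧ (∀ j < d, σ' j = σ j) ∧ σ' d = ρ x ∧
      σ' (d + 3) = if ∃ i' < i, p i' then 1 else 0
  have hI0 : I 0 (update ρ x (it 0)) (update (update σ₂ (d + 2) 0) (d + 3) 0) M := by
    refine ⟨rfl, rfl, fun j hj => ?_, ?_, ?_⟩
    · rw [update_of_ne (by omega), update_of_ne (by omega), h4 j (by omega), h1 j (by omega),
        update_of_ne (by omega)]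
    · rw [update_of_ne (by omega), update_of_ne (by omega), h4 d (by omega), h1 d (by omega),
        update_self]
    · simp
  have hN' : update (update σ₂ (d + 2) 0) (d + 3) 0 (d + 1) = N := by
    rw [update_of_ne (by omega), update_of_ne (by omega), h4 _ (by omega), h2]
  have hi' : update (update σ₂ (d + 2) 0) (d + 3) 0 (d + 2) = 0 := by
    rw [update_of_ne (by omega), update_self]
  let P : Program :=
      .seq (T (d + 4)) <| .seq (.const (2 * (d + 5) + 1) 0) <|
      .seq (.ite (.eq (2 * (d + 4) + 1) (2 * (d + 5) + 1)) .skip (.const (2 * (d + 3) + 1) 1)) <|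
      .seq (S (d + 4)) <| .seq (.copy (2 * x) (2 * (d + 4) + 1)) <|
      .seq (.const (2 * (d + 4) + 1) 1) <|
      .add (2 * (d + 2) + 1) (2 * (d + 2) + 1) (2 * (d + 4) + 1)
  have hstep : ∀ i < N, ∀ ρ' σ' M', I i ρ' σ' M' → σ' (d + 1) = N → σ' (d + 2) = i →
      ∃ ρ'' σ'' M'', Runs W P (.of ρ' σ' M') (.of ρ'' σ'' M'') (c i + (cS + 6)) ∧
        σ'' (d + 1) = N ∧ σ'' (d + 2) = i + 1 ∧ I (i + 1) ρ'' σ'' M'' := by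
    rintro i hi ρ' σ' M' ⟨rfl, rfl, f1, f2, f3⟩ f4 f5
    obtain ⟨σ₄, g1, g2, g3⟩ := hT i hi (d + 4) σ'
    have e1 := runs_const_odd (W := W) (update ρ x (it i)) σ₄ M' (x := d + 5) (c := 0) (by omega)
    obtain ⟨σ₅, g4, g5, e2⟩ : ∃ σ₅, (∀ j < d + 3, σ₅ j = σ' j) ∧
        (σ₅ (d + 3) = if ∃ i' < i + 1, p i' then 1 else 0) ∧
        Runs W (.ite (.eq (2 * (d + 4) + 1) (2 * (d + 5) + 1)) .skip (.const (2 * (d + 3) + 1) 1))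
        (.of (update ρ x (it i)) (update σ₄ (d + 5) 0) M') (.of (update ρ x (it i)) σ₅ M') 2 := by
      have hlt : (∃ i' < i + 1, p i') ↔ (∃ i' < i, p i') ∨ p i := by
        constructor
        · rintro ⟨i', h, h'⟩
          rcases Nat.lt_succ_iff_lt_or_eq.1 h with h | rfl
          exacts [.inl ⟨i', h, h'⟩, .inr h']
        · rintro (⟨i', h, h'⟩ | h)
          exacts [⟨i', by omega, h'⟩, ⟨i, by omega, h⟩]
      by_cases hp : p i
      · refine ⟨_, fun j hj => ?_, ?_, .ite_false ?_ (runs_const_odd _ _ _ hW)⟩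
        · rw [update_of_ne (by omega), update_of_ne (by omega), g1 j (by omega)]
        · rw [update_self, if_pos (hlt.2 (.inr hp))]
        · simp only [Test.Holds, State.of_reg_odd]
          rw [update_of_ne (by omega), update_self, g2, if_pos hp]
          omega
      · refine ⟨_, fun j hj => ?_, ?_, .ite_true ?_ (Exec.skip _).runs⟩
        · rw [update_of_ne (by omega), g1 j (by omega)]
        · rw [update_of_ne (by omega), g1 _ (by omega), f3]
          simp only [hlt, hp, or_false]
        · simp only [Test.Holds, State.of_reg_odd]
          rw [update_of_ne (by omega), update_self, g2, if_neg hp]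
    obtain ⟨σ₆, g6, g7, g8⟩ := hS i hi (d + 4) σ₅
    have e3 := runs_copy_even_odd (W := W) (update ρ x (it i)) σ₆ M' x (d + 4)
    rw [g7, update_idem] at e3
    have e4 := runs_const_odd (W := W) (update ρ x (it (i + 1))) σ₆ M' (x := d + 4) (c := 1) hW
    have g9 : update σ₆ (d + 4) 1 (d + 2) = i := by
      rw [update_of_ne (by omega), g6 _ (by omega), g4 _ (by omega), f5]
    have e5 := runs_add_odd (W := W) (update ρ x (it (i + 1))) (update σ₆ (d + 4) 1) M'
      (x := d + 2) (y := d + 2) (z := d + 4) (by rw [g9, update_self]; omega)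
    rw [g9, update_self] at e5
    refine ⟨_, _, _, (g3.seq (e1.seq (e2.seq (g8.seq (e3.seq (e4.seq e5)))))).mono (by omega),
      ?_, update_self .., rfl, rfl, fun j hj => ?_, ?_, ?_⟩
    · rw [update_of_ne (by omega), update_of_ne (by omega), g6 _ (by omega), g4 _ (by omega), f4]
    · rw [update_of_ne (by omega), update_of_ne (by omega), g6 _ (by omega), g4 _ (by omega),
        f1 j hj]
    · rw [update_of_ne (by omega), update_of_ne (by omega), g6 _ (by omega), g4 _ (by omega), f2]
    · rw [update_of_ne (by omega), update_of_ne (by omega), g6 _ (by omega), g5]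
  obtain ⟨ρ₃, σ₃, M₃, h7, rfl, rfl, h8, h9, h10⟩ :=
    runs_while_count I hstep hI0 hN' hi'
  refine ⟨update σ₃ d (σ₃ (d + 3)), fun j hj => ?_, ?_, ?_⟩
  · rw [update_of_ne (by omega), h8 j hj]
  · rw [update_self, h10]; congr
  · have e1 := runs_copy_odd_even (W := W) ρ σ M₃ d x
    have e2 := runs_copy_even_odd (W := W) ρ σ₂ M₃ x (d + 2)
    rw [h5] at e2
    have e3 := runs_const_odd (W := W) (update ρ x (it 0)) σ₂ M₃ (x := d + 2) (c := 0) (by omega)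
    have e4 := runs_const_odd (W := W) (update ρ x (it 0)) (update σ₂ (d + 2) 0) M₃
      (x := d + 3) (c := 0) (by omega)
    have e5 := runs_copy_even_odd (W := W) (update ρ x (it N)) σ₃ M₃ x d
    rw [h9, update_idem, update_eq_self] at e5
    refine (e1.seq (h3.seq (h6.seq (e2.seq (e3.seq (e4.seq (h7.seq (e5.seq
      (runs_copy_odd_odd (W := W) ρ σ₃ M₃ d (d + 3)))))))))).mono ?_
    simp only [sum_add_distrib, sum_const, card_range, smul_eq_mul]
    ring_nf
    omega

end

/-! ## Code that changes the memory -/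

/-- With variables `ρ`, the code `T` changes the memory from `M` to `M'` in at most `c` steps. -/
def Acts (W : ℕ) (T : Code) (ρ M M' : ℕ → ℕ) (c : ℕ) : Prop :=
  ∀ d σ, ∃ σ', (∀ j < d, σ' j = σ j) ∧ Runs W (T d) (.of ρ σ M) (.of ρ σ' M') c

/-- write the value of `T` into the memory cell with address `A` -/
def Code.write (A T : Code) : Code := fun d =>
  .seq (A d) (.seq (T (d + 1)) (.store (2 * d + 1) (2 * (d + 1) + 1)))

/-- for all values of `x` below `N` do `T` -/
def Code.loop (x : ℕ) (N T : Code) : Code := fun d =>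
  .seq (.copy (2 * d + 1) (2 * x)) <| .seq (N (d + 1)) <| .seq (.const (2 * (d + 2) + 1) 0) <|
  .seq (.while (.lt (2 * (d + 2) + 1) (2 * (d + 1) + 1)) <|
    .seq (.copy (2 * x) (2 * (d + 2) + 1)) <| .seq (T (d + 3)) <|
    .seq (.const (2 * (d + 3) + 1) 1) <|
    .add (2 * (d + 2) + 1) (2 * (d + 2) + 1) (2 * (d + 3) + 1)) <|
  .copy (2 * x) (2 * d + 1)

section
variable {W : ℕ} {ρ M M' : ℕ → ℕ} {A T U : Code} {a v c c' : ℕ}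

lemma Acts.mono (h : Acts W T ρ M M' c) (hc : c ≤ c') : Acts W T ρ M M' c' := fun d σ =>
  let ⟨σ', h1, h2⟩ := h d σ
  ⟨σ', h1, h2.mono hc⟩

lemma Acts.write (h : Val W A ρ M a c) (h' : Val W T ρ M v c') :
    Acts W (.write A T) ρ M (update M a v) (c + c' + 1) := fun d σ => by
  obtain ⟨σ₁, h1, h2, h3⟩ := h d σ
  obtain ⟨σ₂, h4, h5, h6⟩ := h' (d + 1) σ₁
  have h7 : σ₂ d = a := by rw [h4 d (by omega), h2]
  have e := runs_store_odd (W := W) ρ σ₂ M d (d + 1)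
  rw [h7, h5] at e
  exact ⟨σ₂, fun j hj => by rw [h4 j (by omega), h1 j hj], (h3.seq (h6.seq e)).mono (by omega)⟩

lemma Acts.loop {x N cN : ℕ} {B : Code} {m : ℕ → ℕ → ℕ} (hW : 1 < W) (hN : N < W)
    (hB : Val W B ρ (m 0) N cN)
    (hT : ∀ i < N, Acts W T (update ρ x i) (m i) (m (i + 1)) c) :
    Acts W (.loop x B T) ρ (m 0) (m N) (N * (c + 4) + (cN + 4)) := fun d σ => by
  obtain ⟨σ₁, h1, h2, h3⟩ := hB (d + 1) (update σ d (ρ x))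
  -- The variables may differ from ρ only at `x`; this form also covers the start, when `x` has not
  -- yet been assigned the counter.
  let I : ℕ → (ℕ → ℕ) → (ℕ → ℕ) → (ℕ → ℕ) → Prop := fun i ρ' σ' M' =>
    update ρ' x (ρ x) = ρ ∧ M' = m i ∧ (∀ j < d, σ' j = σ j) ∧ σ' d = ρ x
  have hI0 : I 0 ρ (update σ₁ (d + 2) 0) (m 0) := by
    refine ⟨update_eq_self .., rfl, fun j hj => ?_, ?_⟩
    · rw [update_of_ne (by omega), h1 j (by omega), update_of_ne (by omega)]
    · rw [update_of_ne (by omega), h1 d (by omega), update_self]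
  have hN' : update σ₁ (d + 2) 0 (d + 1) = N := by rw [update_of_ne (by omega), h2]
  let P : Program :=
    .seq (.copy (2 * x) (2 * (d + 2) + 1)) <| .seq (T (d + 3)) <|
    .seq (.const (2 * (d + 3) + 1) 1) <|
    .add (2 * (d + 2) + 1) (2 * (d + 2) + 1) (2 * (d + 3) + 1)
  have hstep : ∀ i < N, ∀ ρ' σ' M', I i ρ' σ' M' → σ' (d + 1) = N → σ' (d + 2) = i →
      ∃ ρ'' σ'' M'', Runs W P (.of ρ' σ' M') (.of ρ'' σ'' M'') (c + 3) ∧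
        σ'' (d + 1) = N ∧ σ'' (d + 2) = i + 1 ∧ I (i + 1) ρ'' σ'' M'' := by
    rintro i hi ρ' σ' M' ⟨f1, rfl, f2, f3⟩ f4 f5
    have e1 := runs_copy_even_odd (W := W) ρ' σ' (m i) x (d + 2)
    have f6 : update ρ' x i = update ρ x i := by rw [← f1, update_idem]
    rw [f5, f6] at e1
    obtain ⟨σ₂, g1, e2⟩ := hT i hi (d + 3) σ'
    have e3 := runs_const_odd (W := W) (update ρ x i) σ₂ (m (i + 1)) (x := d + 3) (c := 1) hW
    have g2 : update σ₂ (d + 3) 1 (d + 2) = i := by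
      rw [update_of_ne (by omega), g1 _ (by omega), f5]
    have e4 := runs_add_odd (W := W) (update ρ x i) (update σ₂ (d + 3) 1) (m (i + 1))
      (x := d + 2) (y := d + 2) (z := d + 3) (by rw [g2, update_self]; omega)
    rw [g2, update_self] at e4
    refine ⟨_, _, _, (e1.seq (e2.seq (e3.seq e4))).mono (by omega), ?_, update_self .., ?_, rfl,
      fun j hj => ?_, ?_⟩
    · rw [update_of_ne (by omega), update_of_ne (by omega), g1 _ (by omega), f4]
    · rw [update_idem, update_eq_self]
    · rw [update_of_ne (by omega), update_of_ne (by omega), g1 _ (by omega), f2 j hj]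
    · rw [update_of_ne (by omega), update_of_ne (by omega), g1 _ (by omega), f3]
  obtain ⟨ρ₃, σ₃, M₃, h7, f1, rfl, h8, h9⟩ := runs_while_count I hstep hI0 hN' (update_self ..)
  have e1 := runs_copy_odd_even (W := W) ρ σ (m 0) d x
  have e2 := runs_const_odd (W := W) ρ σ₁ (m 0) (x := d + 2) (c := 0) (by omega)
  have e3 := runs_copy_even_odd (W := W) ρ₃ σ₃ (m N) x d
  rw [h9, f1] at e3
  refine ⟨σ₃, h8, (e1.seq (h3.seq (e2.seq (h7.seq e3)))).mono ?_⟩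
  simp only [sum_const, card_range, smul_eq_mul]
  ring_nf
  omega

end

/-! ## Code about hypergraphs in the memory -/

/-- The memory `M` begins with a hypergraph with vertices `0, …, n - 1` and edges `E j`, `j < m`,
of size at most `k`; the edge `E j` stands at address `ptr j`, after its size. The words are large
enough for the addresses of an `n` by `n` matrix behind the hypergraph. -/
structure Input (W k n m : ℕ) (E : ℕ → List ℕ) (ptr M : ℕ → ℕ) : Prop where
  n_pos : 0 < n
  m_pos : 0 < m
  word : 2 + m * (k + 1) + n * n + k + 2 < W
  mem_zero : M 0 = n
  mem_one : M 1 = m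
  ptr_zero : ptr 0 = 2
  ptr_succ : ∀ j < m, ptr (j + 1) = ptr j + (E j).length + 1
  mem_ptr : ∀ j < m, M (ptr j) = (E j).length
  mem_elem : ∀ j < m, ∀ i < (E j).length, M (ptr j + 1 + i) = (E j).getD i 0
  length_le : ∀ j < m, (E j).length ≤ k
  lt_n : ∀ j < m, ∀ x ∈ E j, x < n

namespace Input

variable {W k n m : ℕ} {E : ℕ → List ℕ} {ptr M : ℕ → ℕ}

lemma ptr_le (h : Input W k n m E ptr M) {j : ℕ} (hj : j ≤ m) : ptr j ≤ 2 + j * (k + 1) := by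
  induction j with
  | zero => rw [h.ptr_zero]; omega
  | succ j ih =>
    have := ih (by omega)
    have := h.length_le j (by omega)
    rw [h.ptr_succ j (by omega), add_one_mul]
    omega

lemma ptr_add_le (h : Input W k n m E ptr M) {j : ℕ} (hj : j < m) :
    ptr j + (E j).length + 1 ≤ 2 + m * (k + 1) := by
  have h1 := h.ptr_le (j := j + 1) (by omega)
  rw [h.ptr_succ j hj] at h1
  exact h1.trans (by gcongr; omega)

lemma one_lt (h : Input W k n m E ptr M) : 1 < W := by have := h.word; omega

lemma m_lt (h : Input W k n m E ptr M) : m < W := by have := h.word; nlinarith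

lemma n_lt (h : Input W k n m E ptr M) : n < W := by have := h.word; nlinarith [h.n_pos]

/-- The hypergraph stands below address 2 + m(k + 1), where the matrix begins, so writing matrix
entries does not disturb it. -/
lemma of_agree (h : Input W k n m E ptr M) {M' : ℕ → ℕ}
    (hM : ∀ a < 2 + m * (k + 1), M' a = M a) : Input W k n m E ptr M' where
  __ := h
  mem_zero := by rw [hM _ (by omega), h.mem_zero]
  mem_one := by rw [hM _ (by omega), h.mem_one]
  mem_ptr j hj := by rw [hM _ (by have := h.ptr_add_le hj; omega), h.mem_ptr j hj]
  mem_elem j hj i hi := by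
    rw [hM _ (by have := h.ptr_add_le hj; omega), h.mem_elem j hj i hi]

end Input

namespace Code

/-- a successor -/
def succ (T : Code) : Code := plus T (lit 1)

/-- existential quantification over the vertices -/
def existVertex (x : ℕ) (T : Code) : Code := exist x (lit 0) (fetch (lit 0)) (succ (var x)) T

/-- existential quantification over the addresses of the edges -/
def existEdge (x : ℕ) (T : Code) : Code :=
  exist x (lit 2) (fetch (lit 1)) (succ (plus (var x) (fetch (var x)))) T

/-- existential quantification over the addresses of the elements of the edge with address `p` -/
def existElem (x p : ℕ) (T : Code) : Code :=
  exist x (succ (var p)) (fetch (var p)) (succ (var x)) T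

/-- membership in the edge with address `p`; this uses the variable `6` -/
def memEdge (p : ℕ) (T : Code) : Code := existElem 6 p (equal (fetch (var 6)) T)

/-- adjacency of the vertices `0` and `1` in the co-occurrence graph of the dual -/
def dualAdj : Code :=
  existEdge 2 <| conj (conj (memEdge 2 (var 0)) (neg (memEdge 2 (var 1)))) <|
  existEdge 3 <| conj (conj (memEdge 3 (var 1)) (neg (memEdge 3 (var 0)))) <|
  neg <| existEdge 4 <| neg <| existElem 5 4 <|
  conj (neg (conj (memEdge 2 (fetch (var 5))) (neg (equal (fetch (var 5)) (var 0)))))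
    (neg (conj (memEdge 3 (fetch (var 5))) (neg (equal (fetch (var 5)) (var 1)))))

/-- the address of an entry of the matrix behind the hypergraph -/
def entry (k : ℕ) (T U : Code) : Code :=
  plus (plus (lit 2) (times (fetch (lit 1)) (lit (k + 1)))) (plus (times T (fetch (lit 0))) U)

/-- the adjacency of two vertices according to the matrix -/
def adj (k : ℕ) (T U : Code) : Code := equal (fetch (entry k T U)) (lit 1)

/-- Fill the matrix. -/
def fill (k : ℕ) : Code :=
  loop 0 (fetch (lit 0)) <| loop 1 (fetch (lit 0)) <| write (entry k (var 0) (var 1)) dualAdj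

/-- Each vertex has a neighbourhood that is no transversal. -/
def noTransversal (k : ℕ) : Code :=
  neg <| existVertex 1 <| neg <| existEdge 2 <| neg <| existElem 5 2 <|
  adj k (fetch (var 5)) (var 1)

/-- The vertex `10 + i` is equal or adjacent to the vertices `10, …, 9 + l`. -/
def joined (k i : ℕ) : ℕ → Code
  | 0 => equal (lit 0) (lit 0)
  | l + 1 => conj (joined k i l)
      (disj (equal (var (10 + l)) (var (10 + i))) (adj k (var (10 + l)) (var (10 + i))))

/-- The clique with the vertices `10, …, 9 + i` can be extended so as to obstruct the edge with
address `2`, whose size is at most `i + r`. -/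
def obstructed (k : ℕ) : ℕ → ℕ → Code
  | 0, _ => equal (lit 0) (lit 0)
  | r + 1, i => disj (equal (fetch (var 2)) (lit i)) <| existVertex (10 + i) <|
      conj (neg (equal (var (10 + i)) (fetch (plus (var 2) (lit (i + 1)))))) <|
      conj (neg (adj k (fetch (plus (var 2) (lit (i + 1)))) (var (10 + i)))) <|
      conj (joined k i i) (obstructed k r (i + 1))

/-- the decision procedure, after the matrix has been filled -/
def answer (k : ℕ) : Code :=
  conj (neg (existEdge 2 (obstructed k k 0))) (noTransversal k)

end Code

/-- Adjacency in the co-occurrence graph of the dual of a hypergraph with edges `E j`, `j < m`. -/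
def DualAdj (m : ℕ) (E : ℕ → List ℕ) (u v : ℕ) : Prop :=
  ∃ e < m, (u ∈ E e ∧ v ∉ E e) ∧ ∃ f < m, (v ∈ E f ∧ u ∉ E f) ∧
    ∀ g < m, ∃ x ∈ E g, ¬ (x ∈ E e ∧ x ≠ u) ∧ ¬ (x ∈ E f ∧ x ≠ v)

lemma Val.var' {W x v : ℕ} {ρ M : ℕ → ℕ} (h : ρ x = v) : Val W (.var x) ρ M v 1 :=
  h ▸ Val.var x

lemma Val.fetch' {W a v c : ℕ} {T : Code} {ρ M : ℕ → ℕ} (h : Val W T ρ M a c) (hv : M a = v) :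
    Val W (.fetch T) ρ M v (c + 1) :=
  hv ▸ h.fetch

lemma Val.succ {W v c : ℕ} {T : Code} {ρ M : ℕ → ℕ} (h : Val W T ρ M v c) (hv : v + 1 < W) :
    Val W (.succ T) ρ M (v + 1) (c + 2) :=
  (h.plus (Val.lit (by omega)) hv).mono (by omega)

section
variable {W k n m : ℕ} {E : ℕ → List ℕ} {ptr M ρ : ℕ → ℕ}

lemma Dec.existVertex (h : Input W k n m E ptr M) {x c : ℕ} {T : Code} {p : ℕ → Prop}
    (hT : ∀ v < n, Dec W T (update ρ x v) M (p v) c) :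
    Dec W (.existVertex x T) ρ M (∃ v < n, p v) (n * (c + 10) + 10) := by
  have h1 := h.one_lt
  have h2 := h.n_lt
  refine (Dec.exist (it := fun i => i) (c := fun _ => c) (cS := 3) h1 h2 (Val.lit (by omega))
    ((Val.lit (by omega)).fetch' h.mem_zero) (fun i hi => ?_) hT).mono ?_
  · exact (Val.var' (by simp)).succ (by omega)
  · simp only [sum_const, card_range, smul_eq_mul]
    ring_nf; omega

/-- Adding the stored size and 1 to the address of an edge gives the next address. The costs `c j`
may vary with the edge, since expensive bodies occur for few edges only. -/
lemma Dec.existEdge (h : Input W k n m E ptr M) {x : ℕ} {c : ℕ → ℕ} {T : Code} {p : ℕ → Prop}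
    (hT : ∀ j < m, Dec W T (update ρ x (ptr j)) M (p j) (c j)) :
    Dec W (.existEdge x T) ρ M (∃ j < m, p j) (∑ j ∈ range m, c j + m * 13 + 10) := by
  have h1 := h.word
  refine (Dec.exist (it := ptr) (c := c) (cA := 1) (cS := 6) h.one_lt h.m_lt ?_
    ((Val.lit h.one_lt).fetch' h.mem_one) (fun j hj => ?_) hT).mono ?_
  · rw [h.ptr_zero]; exact Val.lit (by omega)
  · have h2 := h.ptr_add_le hj
    have e : Val W (.var x) (update ρ x (ptr j)) M (ptr j) 1 := Val.var' (by simp)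
    rw [h.ptr_succ j hj]
    exact (e.plus (e.fetch' (h.mem_ptr j hj)) (by omega)).succ (by omega)
  · omega

lemma Dec.existElem (h : Input W k n m E ptr M) {x q j c : ℕ} {T : Code} {p : ℕ → Prop}
    (hj : j < m) (hq : ρ q = ptr j)
    (hT : ∀ a, M a ∈ E j → Dec W T (update ρ x a) M (p (M a)) c) :
    Dec W (.existElem x q T) ρ M (∃ v ∈ E j, p v) (k * (c + 10) + 12) := by
  have h1 := h.word
  have h2 := h.ptr_add_le hj
  have h3 := h.length_le j hj
  have hM : ∀ i < (E j).length, M (ptr j + 1 + i) ∈ E j := fun i hi => by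
    rw [h.mem_elem j hj i hi, List.getD_eq_getElem _ _ hi]
    exact List.getElem_mem hi
  have e : Val W (.var q) ρ M (ptr j) 1 := Val.var' hq
  refine ((Dec.exist (it := fun i => ptr j + 1 + i) (c := fun _ => c) (cS := 3)
    (p := fun i => p (M (ptr j + 1 + i))) (N := (E j).length) h.one_lt (by omega)
    (e.succ (by omega)) (e.fetch' (h.mem_ptr j hj)) (fun i hi => ?_)
    fun i hi => hT _ (hM i hi)).mono ?_).congr ?_
  · exact Val.succ (v := ptr j + 1 + i) (Val.var' (by simp)) (by omega)
  · simp only [sum_const, card_range, smul_eq_mul]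
    have : (E j).length * (c + 10) ≤ k * (c + 10) := Nat.mul_le_mul_right _ h3
    linarith
  · constructor
    · rintro ⟨i, hi, hp⟩
      exact ⟨_, hM i hi, hp⟩
    · rintro ⟨v, hv, hp⟩
      obtain ⟨i, hi, rfl⟩ := List.getElem_of_mem hv
      refine ⟨i, hi, ?_⟩
      rwa [h.mem_elem j hj i hi, List.getD_eq_getElem _ _ hi]

/-- The term is reevaluated in every round of the search, so its value must not depend on the search
variable 6. -/
lemma Dec.memEdge (h : Input W k n m E ptr M) {q j v : ℕ} {T : Code} (hj : j < m)
    (hq : ρ q = ptr j) (hT : ∀ a, Val W T (update ρ 6 a) M v 2) :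
    Dec W (.memEdge q T) ρ M (v ∈ E j) (k * 16 + 12) :=
  ((Dec.existElem h hj hq (p := fun x => x = v) (c := 6) fun a _ =>
    (Dec.equal h.one_lt (Val.var' (v := a) (by simp)).fetch (hT _)).mono (by omega)).mono
      (by omega)).congr (by simp)

/-- At most Δ edges contain v, so the surcharge B is paid at most Δ times. -/
lemma sum_mem_le {Δ A B : ℕ} {P : ℕ → Prop} [DecidablePred P] {v : ℕ}
    (hΔ : ((range m).filter fun j => v ∈ E j).card ≤ Δ) (hP : ∀ j, P j → v ∈ E j) :
    ∑ j ∈ range m, (A + if P j then B else 0) ≤ m * A + Δ * B := by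
  rw [sum_add_distrib, sum_const, card_range, smul_eq_mul, ← sum_filter, sum_const, smul_eq_mul]
  gcongr
  refine (card_le_card fun j hj => ?_).trans hΔ
  rw [mem_filter] at hj ⊢
  exact ⟨hj.1, hP j hj.2⟩

/-- One scan finds the at most Δ candidates for e, and for each of them another scan finds the at
most Δ candidates for f; only then are all edges g inspected. Since Δ ≥ 1, the scans are absorbed by
m Δ². -/
lemma Dec.dualAdj (h : Input W k n m E ptr M) {Δ u v : ℕ} (hΔ0 : 0 < Δ)
    (hΔ : ∀ x < n, ((range m).filter fun j => x ∈ E j).card ≤ Δ) (hu : u < n) (hv : v < n)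
    (hρu : ρ 0 = u) (hρv : ρ 1 = v) :
    Dec W .dualAdj ρ M (DualAdj m E u v) (200 * (k + 1) ^ 2 * (m * Δ ^ 2)) := by
  have hW := h.one_lt
  have hm := h.m_pos
  -- Cost bounds from the inside out: K for a membership test, K₂ for one edge g, K₃ for all g, K₄
  -- for the search for f.
  set K := k * 16 + 12 with hK
  set K₂ := k * (2 * K + 41) + 12 with hK₂
  set K₃ := m * (K₂ + 29) with hK₃
  set K₄ := m * (2 * K + 9) + Δ * K₃ + m * 13 + 10 with hK₄
  have hg : ∀ e < m, ∀ f < m, Dec W (.neg <| .existEdge 4 <| .neg <| .existElem 5 4 <|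
      .conj (.neg (.conj (.memEdge 2 (.fetch (.var 5)))
        (.neg (.equal (.fetch (.var 5)) (.var 0)))))
      (.neg (.conj (.memEdge 3 (.fetch (.var 5))) (.neg (.equal (.fetch (.var 5)) (.var 1))))))
      (update (update ρ 2 (ptr e)) 3 (ptr f)) M
      (∀ g < m, ∃ x ∈ E g, ¬ (x ∈ E e ∧ x ≠ u) ∧ ¬ (x ∈ E f ∧ x ≠ v)) K₃ := by
    intro e he f hf
    refine ((Dec.neg hW (Dec.existEdge h (c := fun _ => K₂ + 3) fun g hg => Dec.neg hW
      (Dec.existElem h hg (by simp)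
        (p := fun x => ¬ (x ∈ E e ∧ x ≠ u) ∧ ¬ (x ∈ E f ∧ x ≠ v)) (c := 2 * K + 31) fun a ha =>
      ((Dec.neg hW ((Dec.memEdge h he (by simp) fun b => (Val.var' (by simp)).fetch).conj' hW
        fun _ => (Dec.equal hW (Val.var' (by simp)).fetch
          (Val.var' (v := u) (by simp [hρu]))).neg hW)).conj' hW fun _ =>
      (Dec.neg hW ((Dec.memEdge h hf (by simp) fun b => (Val.var' (by simp)).fetch).conj' hW
        fun _ => (Dec.equal hW (Val.var' (by simp)).fetch
          (Val.var' (v := v) (by simp [hρv]))).neg hW))).mono (by omega)))).mono ?_).congr ?_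
    · simp only [sum_const, card_range, smul_eq_mul]
      nlinarith
    · push Not; rfl
  have hf : ∀ e < m, Dec W (.existEdge 3 <| .conj
      (.conj (.memEdge 3 (.var 1)) (.neg (.memEdge 3 (.var 0)))) <|
      (.neg <| .existEdge 4 <| .neg <| .existElem 5 4 <|
      .conj (.neg (.conj (.memEdge 2 (.fetch (.var 5)))
        (.neg (.equal (.fetch (.var 5)) (.var 0)))))
      (.neg (.conj (.memEdge 3 (.fetch (.var 5))) (.neg (.equal (.fetch (.var 5)) (.var 1)))))))
      (update ρ 2 (ptr e)) M
      (∃ f < m, (v ∈ E f ∧ u ∉ E f) ∧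
        ∀ g < m, ∃ x ∈ E g, ¬ (x ∈ E e ∧ x ≠ u) ∧ ¬ (x ∈ E f ∧ x ≠ v)) K₄ := by
    intro e he
    refine (Dec.existEdge h (c := fun f => 2 * K + 9 + if v ∈ E f ∧ u ∉ E f then K₃ else 0)
      fun f hf => (((Dec.memEdge h hf (by simp) fun b => (Val.var' (by simp [hρv])).mono
        (by omega)).conj' hW fun _ => (Dec.memEdge h hf (by simp) fun b =>
        (Val.var' (by simp [hρu])).mono (by omega)).neg hW).conj hW fun _ => hg e he f hf).mono
        (by omega)).mono ?_
    have := sum_mem_le (A := 2 * K + 9) (B := K₃) (P := fun f => v ∈ E f ∧ u ∉ E f) (hΔ v hv)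
      fun j hj => hj.1
    omega
  refine (Dec.existEdge h (c := fun e => 2 * K + 9 + if u ∈ E e ∧ v ∉ E e then K₄ else 0)
      fun e he => (((Dec.memEdge h he (by simp) fun b => (Val.var' (by simp [hρu])).mono
        (by omega)).conj' hW fun _ => (Dec.memEdge h he (by simp) fun b =>
        (Val.var' (by simp [hρv])).mono (by omega)).neg hW).conj hW fun _ => hf e he).mono
        (by omega)).mono ?_
  have h1 := sum_mem_le (A := 2 * K + 9) (B := K₄) (P := fun e => u ∈ E e ∧ v ∉ E e) (hΔ u hu)
    fun j hj => hj.1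
  have h2 : K₄ ≤ (2 * K + 32 + (K₂ + 29)) * (m * Δ) := by
    have h3 : m ≤ m * Δ := Nat.le_mul_of_pos_right m hΔ0
    rw [hK₄, hK₃]
    nlinarith
  have h3 : m ≤ m * Δ ^ 2 := Nat.le_mul_of_pos_right m (by positivity)
  have h4 : Δ * K₄ ≤ (2 * K + 32 + (K₂ + 29)) * (m * Δ ^ 2) := by
    calc Δ * K₄ ≤ Δ * ((2 * K + 32 + (K₂ + 29)) * (m * Δ)) := by gcongr
      _ = _ := by ring
  calc _ ≤ m * (2 * K + 9) + Δ * K₄ + m * 13 + 10 := by gcongr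
    _ ≤ (2 * K + 32) * m + (2 * K + 32 + (K₂ + 29)) * (m * Δ ^ 2) := by nlinarith
    _ ≤ (2 * K + 32) * (m * Δ ^ 2) + (2 * K + 32 + (K₂ + 29)) * (m * Δ ^ 2) := by gcongr
    _ = (4 * K + 93 + K₂) * (m * Δ ^ 2) := by ring
    _ ≤ _ := by
      gcongr
      rw [hK₂, hK]
      nlinarith

/-- The memory `M` after `t` entries of the matrix at address `B` have been filled. -/
noncomputable def filled (m n B : ℕ) (E : ℕ → List ℕ) (M : ℕ → ℕ) (t : ℕ) : ℕ → ℕ := by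
  classical
  exact fun a => if B ≤ a ∧ a < B + t then
    if DualAdj m E ((a - B) / n) ((a - B) % n) then 1 else 0 else M a

lemma filled_of_lt {B t a : ℕ} (ha : a < B) : filled m n B E M t a = M a := by
  simp [filled, ha.not_ge]

lemma filled_zero (B : ℕ) : filled m n B E M 0 = M := by
  funext a
  simp only [filled, ite_eq_right_iff]
  omega

open Classical in
-- The matrix is filled row by row, and u n + v is the position of the entry (u, v).
lemma update_filled {B u v : ℕ} (hv : v < n) :
    update (filled m n B E M (u * n + v)) (B + (u * n + v)) (if DualAdj m E u v then 1 else 0) =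
      filled m n B E M (u * n + v + 1) := by
  funext a
  have h1 : (u * n + v) / n = u := by
    rw [mul_comm, Nat.mul_add_div (by omega), Nat.div_eq_of_lt hv, add_zero]
  have h2 : (u * n + v) % n = v := by
    rw [mul_comm, Nat.mul_add_mod, Nat.mod_eq_of_lt hv]
  rcases eq_or_ne a (B + (u * n + v)) with rfl | ha
  · rw [update_self]
    simp [filled, h1, h2]
  · rw [update_of_ne ha]
    have : (B ≤ a ∧ a < B + (u * n + v)) ↔ (B ≤ a ∧ a < B + (u * n + v + 1)) := by omega
    simp only [filled, this]

lemma Val.entry (h : Input W k n m E ptr M) {T U : Code} {u v c c' : ℕ}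
    (hT : Val W T ρ M u c) (hU : Val W U ρ M v c') (hu : u < n) (hv : v < n) :
    Val W (.entry k T U) ρ M (2 + m * (k + 1) + (u * n + v)) (c + c' + 11) := by
  have h1 := h.word
  have h2 : u * n + v < n * n := by nlinarith
  exact (((Val.lit (by omega)).plus (((Val.lit h.one_lt).fetch' h.mem_one).times
    (Val.lit (by omega)) (by omega)) (by omega)).plus
    ((hT.times ((Val.lit (by omega)).fetch' h.mem_zero) (by omega)).plus hU (by omega))
    (by omega)).mono (by omega)

lemma Acts.fill (h : Input W k n m E ptr M) {Δ : ℕ} (hΔ0 : 0 < Δ)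
    (hΔ : ∀ x < n, ((range m).filter fun j => x ∈ E j).card ≤ Δ) :
    Acts W (.fill k) ρ M (filled m n (2 + m * (k + 1)) E M (n * n))
      (250 * (k + 1) ^ 2 * (m * n ^ 2 * Δ ^ 2)) := by
  have hn := h.n_pos
  have hm := h.m_pos
  have hin : ∀ t, Input W k n m E ptr (filled m n (2 + m * (k + 1)) E M t) := fun t =>
    h.of_agree fun a ha => filled_of_lt ha
  have hval : ∀ ρ' t, Val W (.fetch (.lit 0)) ρ' (filled m n (2 + m * (k + 1)) E M t) n 2 :=
    fun ρ' t => (Val.lit (by have := h.one_lt; omega)).fetch' (hin t).mem_zero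
  set D := 200 * (k + 1) ^ 2 * (m * Δ ^ 2) with hD
  have := Acts.loop (W := W) (ρ := ρ) (x := 0) (c := n * (D + 18) + 6)
    (m := fun u => filled m n (2 + m * (k + 1)) E M (u * n)) h.one_lt h.n_lt (hval _ _)
    (T := .loop 1 (.fetch (.lit 0)) <| .write (.entry k (.var 0) (.var 1)) .dualAdj) fun u hu => by
      have := Acts.loop (W := W) (ρ := update ρ 0 u) (x := 1) (c := D + 14)
        (m := fun v => filled m n (2 + m * (k + 1)) E M (u * n + v)) h.one_lt h.n_lt (hval _ _)
        (T := .write (.entry k (.var 0) (.var 1)) .dualAdj) fun v hv => by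
          have := Acts.write (Val.entry (hin (u * n + v)) (ρ := update (update ρ 0 u) 1 v)
            (Val.var' (x := 0) (by simp)) (Val.var' (x := 1) (by simp)) hu hv)
            (Dec.dualAdj (hin (u * n + v)) hΔ0 hΔ hu hv (by simp) (by simp))
          rw [update_filled hv] at this
          exact this.mono (by omega)
      -- The end u n + n of row u is the beginning (u + 1) n of the next row.
      simp only [add_zero, ← add_one_mul] at this
      exact this.mono (by ring_nf; omega)
  simp only [zero_mul, filled_zero] at this
  refine this.mono ?_
  have hpos : 0 < m * Δ ^ 2 := by positivity
  have hD' : D + 38 ≤ 250 * (k + 1) ^ 2 * (m * Δ ^ 2) := by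
    have : 0 < (k + 1) ^ 2 * (m * Δ ^ 2) := by positivity
    rw [hD]
    linarith
  calc n * (n * (D + 18) + 6 + 4) + (2 + 4) ≤ n ^ 2 * (D + 38) := by nlinarith
    _ ≤ n ^ 2 * (250 * (k + 1) ^ 2 * (m * Δ ^ 2)) := by gcongr
    _ = _ := by ring

end

/-! ### Testing the two conditions on the matrix -/

section
variable {W k n m : ℕ} {E : ℕ → List ℕ} {ptr M ρ : ℕ → ℕ} {G : ℕ → ℕ → Prop}

lemma filled_entry_eq_one_iff {B u v : ℕ} (hu : u < n) (hv : v < n) :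
    filled m n B E M (n * n) (B + (u * n + v)) = 1 ↔ DualAdj m E u v := by
  have h1 : (u * n + v) / n = u := by
    rw [mul_comm, Nat.mul_add_div (by omega), Nat.div_eq_of_lt hv, add_zero]
  have h2 : (u * n + v) % n = v := by
    rw [mul_comm, Nat.mul_add_mod, Nat.mod_eq_of_lt hv]
  have h3 : u * n + v < n * n := by nlinarith
  simp [filled, h1, h2, h3]

lemma Dec.adj (h : Input W k n m E ptr M)
    (hG : ∀ u < n, ∀ v < n, (M (2 + m * (k + 1) + (u * n + v)) = 1 ↔ G u v))
    {T U : Code} {u v c c' : ℕ} (hT : Val W T ρ M u c) (hU : Val W U ρ M v c')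
    (hu : u < n) (hv : v < n) : Dec W (.adj k T U) ρ M (G u v) (c + c' + 15) :=
  ((Dec.equal h.one_lt (Val.entry h hT hU hu hv).fetch (Val.lit h.one_lt)).mono (by omega)).congr
    (hG u hu v hv)

lemma Dec.noTransversal (h : Input W k n m E ptr M)
    (hG : ∀ u < n, ∀ v < n, (M (2 + m * (k + 1) + (u * n + v)) = 1 ↔ G u v)) :
    Dec W (.noTransversal k) ρ M (∀ v < n, ∃ e < m, ∀ x ∈ E e, ¬ G x v)
      (100 * (k + 1) * (n * m)) := by
  have hW := h.one_lt
  have hn := h.n_pos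
  have hm := h.m_pos
  refine ((Dec.neg hW (Dec.existVertex h (p := fun v => ¬ ∃ e < m, ¬ ∃ x ∈ E e, G x v)
    (c := (28 * k + 28 + 10) * m + 13) fun v hv =>
    Dec.neg hW <| (Dec.existEdge h (c := fun _ => 28 * k + 15) fun e he => Dec.neg hW <|
    (Dec.existElem h he (p := fun x => G x v) (c := 18) (by simp) fun a ha =>
    Dec.adj h hG (Val.var' (v := a) (by simp)).fetch (Val.var' (v := v) (by simp))
      (h.lt_n e he _ ha) hv).mono (by omega)).mono ?_)).mono ?_).congr ?_
  · simp only [sum_const, card_range, smul_eq_mul]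
    nlinarith
  · have : n ≤ n * m := Nat.le_mul_of_pos_right n hm
    have : 0 ≤ k * (n * m) := by positivity
    nlinarith
  · push Not; rfl

/-- The vertex `y i` is joined to all preceding ones, and obstructs the `i`-th element of `e`. -/
def Obstructs (n : ℕ) (G : ℕ → ℕ → Prop) (e : List ℕ) (y : ℕ → ℕ) (i : ℕ) : Prop :=
  y i < n ∧ y i ≠ e.getD i 0 ∧ ¬ G (e.getD i 0) (y i) ∧ ∀ l < i, y l = y i ∨ G (y l) (y i)

lemma Dec.joined (h : Input W k n m E ptr M)
    (hG : ∀ u < n, ∀ v < n, (M (2 + m * (k + 1) + (u * n + v)) = 1 ↔ G u v)) {i : ℕ}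
    (hρ : ∀ j ≤ i, ρ (10 + j) < n) {l : ℕ} (hl : l ≤ i) :
    Dec W (.joined k i l) ρ M
      (∀ j < l, ρ (10 + j) = ρ (10 + i) ∨ G (ρ (10 + j)) (ρ (10 + i))) (36 * l + 4) := by
  have hW := h.one_lt
  induction l with
  | zero => exact (Dec.equal hW (Val.lit (by omega)) (Val.lit (by omega))).congr (by simp)
  | succ l ih =>
    refine (((ih (by omega)).conj' hW fun _ => Dec.disj hW (Dec.equal hW (.var _) (.var _))
      fun _ => Dec.adj h hG (.var _) (.var _) (hρ l (by omega)) (hρ i le_rfl)).mono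
        (by omega)).congr ?_
    constructor
    · rintro ⟨h1, h2⟩ j hj
      rcases Nat.lt_succ_iff_lt_or_eq.1 hj with hj | rfl
      exacts [h1 j hj, h2]
    · exact fun h1 => ⟨fun j hj => h1 j (by omega), h1 l (by omega)⟩

/-- A backtracking search of depth at most k: the first i choices stand in the variables from 10 on,
and r levels with n choices each remain. It succeeds as soon as i reaches the size of e. -/
lemma Dec.obstructed (h : Input W k n m E ptr M)
    (hG : ∀ u < n, ∀ v < n, (M (2 + m * (k + 1) + (u * n + v)) = 1 ↔ G u v)) {e : ℕ} (he : e < m)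
    {r i : ℕ} (hri : r + i = k) (hi : i ≤ (E e).length) (hρe : ρ 2 = ptr e)
    (hρ : ∀ j < i, ρ (10 + j) < n) :
    Dec W (.obstructed k r i) ρ M
      (∃ y : ℕ → ℕ, (∀ j < i, y j = ρ (10 + j)) ∧
        ∀ j < (E e).length, i ≤ j → Obstructs n G (E e) y j)
      ((r + 1) * (36 * k + 110) * n ^ r) := by
  have hW := h.one_lt
  have hn := h.n_pos
  have hlen := h.length_le e he
  have hword := h.word
  induction r generalizing i ρ with
  | zero =>
    refine ((Dec.equal hW (Val.lit (by omega)) (Val.lit (by omega))).congr ?_).mono (by simp)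
    -- Here i = k is at least the size of e, so no element is left to obstruct.
    refine ⟨fun _ => ⟨fun j => ρ (10 + j), fun _ _ => rfl, fun j hj hij => by omega⟩, fun _ => rfl⟩
  | succ r ih =>
    have hx : ∀ v, i ≠ (E e).length → Val W (.fetch (.plus (.var 2) (.lit (i + 1))))
        (update ρ (10 + i) v) M ((E e).getD i 0) 4 := fun v hne => by
      have h1 := h.ptr_add_le he
      exact ((Val.var' (x := 2) (v := ptr e) (by
        rw [update_of_ne (by omega), hρe])).plus (Val.lit (by omega)) (by omega)).fetch' (by
        rw [← h.mem_elem e he i (by omega)]; congr 1; omega)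
    have hxn : i ≠ (E e).length → (E e).getD i 0 < n := fun hne => by
      rw [List.getD_eq_getElem _ _ (by omega)]
      exact h.lt_n e he _ (List.getElem_mem _)
    have hup : ∀ v < n, ∀ j ≤ i, update ρ (10 + i) v (10 + j) < n := fun v hv j hj => by
      rcases hj.lt_or_eq with hj | rfl
      · rw [update_of_ne (by omega)]; exact hρ j hj
      · rwa [update_self]
    refine ((Dec.disj hW (Dec.equal hW ((Val.var' hρe).fetch' (h.mem_ptr e he))
      (Val.lit (v := i) (by omega))) fun hne => Dec.existVertex h
      (c := (36 * k + 60) + (r + 1) * (36 * k + 110) * n ^ r)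
      fun v hv => (Dec.conj' hW (Dec.neg hW (Dec.equal hW (Val.var' (v := v) (by simp))
        (hx v (Ne.symm hne)))) fun _ => Dec.conj' hW (Dec.neg hW (Dec.adj h hG (hx v (Ne.symm hne))
        (Val.var' (v := v) (by simp)) (hxn (Ne.symm hne)) hv)) fun _ =>
        Dec.conj' hW (Dec.joined h hG (hup v hv) le_rfl) fun _ =>
        ih (by omega) (by omega) (by rw [update_of_ne (by omega), hρe])
          fun j hj => hup v hv j (by omega)).mono ?_).mono ?_).congr ?_
    · have : 36 * i ≤ 36 * k := by omega
      omega
    · have h1 : 1 ≤ n ^ (r + 1) := Nat.one_le_pow _ _ hn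
      have h2 : n ≤ n ^ (r + 1) := Nat.le_self_pow (by omega) n
      -- The new level adds at most (36k + 70) n + 40 ≤ (36k + 110) n^(r+1) steps, one more copy of
      -- the coefficient.
      calc _ ≤ (36 * k + 70) * n + (r + 1) * (36 * k + 110) * (n ^ r * n) + 40 := by
            ring_nf; omega
        _ ≤ (36 * k + 70) * n ^ (r + 1) + (r + 1) * (36 * k + 110) * n ^ (r + 1)
            + 40 * n ^ (r + 1) := by
          rw [← pow_succ]
          gcongr
          omega
        _ = _ := by ring
    · constructor
      · rintro (heq | ⟨v, hv, h1, h2, h3, y, hy, hy'⟩)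
        · exact ⟨fun j => ρ (10 + j), fun _ _ => rfl, fun j hj hij => by omega⟩
        · have hyi : y i = v := by rw [hy i (by omega), update_self]
          refine ⟨y, fun j hj => ?_, fun j hj hij => ?_⟩
          · rw [hy j (by omega), update_of_ne (by omega)]
          · rcases hij.eq_or_lt with rfl | hij
            · refine ⟨by rwa [hyi], by rwa [hyi], by rwa [hyi], fun l hl => ?_⟩
              rw [hy l (by omega), hyi]
              simpa using h3 l hl
            · exact hy' j hj hij
      · rintro ⟨y, hy, hy'⟩
        by_cases heq : (E e).length = i
        · exact .inl heq
        · obtain ⟨h1, h2, h3, h4⟩ := hy' i (by omega) le_rfl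
          have hyj : ∀ j < i + 1, y j = update ρ (10 + i) (y i) (10 + j) := fun j hj => by
            rcases Nat.lt_succ_iff_lt_or_eq.1 hj with hj | rfl
            · rw [hy j hj, update_of_ne (by omega)]
            · rw [update_self]
          refine .inr ⟨y i, h1, h2, h3, fun l hl => ?_, y, hyj, fun j hj hij => hy' j hj (by omega)⟩
          rw [← hyj l (by omega), update_self]
          exact h4 l hl

/-- Dual conformality of the hypergraph with vertices `0, …, n - 1` and edges `E j`, `j < m`. -/
def DuallyConformal (n m : ℕ) (E : ℕ → List ℕ) : Prop :=
  (¬ ∃ e < m, ∃ y : ℕ → ℕ, ∀ j < (E e).length, Obstructs n (DualAdj m E) (E e) y j) ∧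
    ∀ v < n, ∃ e < m, ∀ x ∈ E e, ¬ DualAdj m E x v

lemma Dec.answer (h : Input W k n m E ptr M)
    (hG : ∀ u < n, ∀ v < n, (M (2 + m * (k + 1) + (u * n + v)) = 1 ↔ DualAdj m E u v)) :
    Dec W (.answer k) ρ M (DuallyConformal n m E)
      ((k + 2) * (36 * k + 110) * (m * n ^ k) + 100 * (k + 1) * (n * m)) := by
  have hW := h.one_lt
  have hn := h.n_pos
  have hm := h.m_pos
  refine ((Dec.conj' hW (Dec.neg hW (Dec.existEdge h
    (c := fun _ => (k + 1) * (36 * k + 110) * n ^ k) fun e he =>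
    Dec.obstructed h hG he (i := 0) (by omega) (by omega) (by simp) (by omega)))
    fun _ => Dec.noTransversal h hG).mono ?_).congr ?_
  · simp only [sum_const, card_range, smul_eq_mul]
    have h1 : m ≤ m * n ^ k := Nat.le_mul_of_pos_right m (by positivity)
    have h2 : 0 ≤ k * (m * n ^ k) := by positivity
    nlinarith
  · simp [DuallyConformal]

/-- the decision procedure -/
def procedure (k : ℕ) : Program :=
  -- Register 1 is scratch register 0, where the truth value is left.
  .seq (Code.fill k 0) (.seq (Code.answer k 0) (.copy 0 1))

lemma runs_procedure (h : Input W k n m E ptr M) {Δ : ℕ} (hΔ0 : 0 < Δ)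
    (hΔ : ∀ x < n, ((range m).filter fun j => x ∈ E j).card ≤ Δ) :
    ∃ s, Runs W (procedure k) ⟨fun _ => 0, M⟩ s
      (800 * (k + 1) ^ 2 * (m * n ^ 2 * Δ ^ 2 + m * n ^ k)) ∧
      (DuallyConformal n m E → s.reg 0 = 1) ∧ (¬ DuallyConformal n m E → s.reg 0 = 0) := by
  obtain ⟨σ₁, -, h1⟩ := Acts.fill (ρ := fun _ => 0) h hΔ0 hΔ 0 (fun _ => 0)
  have h' : Input W k n m E ptr (filled m n (2 + m * (k + 1)) E M (n * n)) :=
    h.of_agree fun a ha => filled_of_lt ha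
  obtain ⟨σ₂, -, h2, h3⟩ := Dec.answer (ρ := fun _ => 0) h'
    (fun u hu v hv => filled_entry_eq_one_iff hu hv) 0 σ₁
  have h4 := runs_copy_even_odd (W := W) (fun _ => 0) σ₂
    (filled m n (2 + m * (k + 1)) E M (n * n)) 0 0
  have h5 := h1.seq (h3.seq h4)
  have h0 : State.of (fun _ => 0) (fun _ => 0) M = ⟨fun _ => 0, M⟩ := by simp [State.of]
  rw [h0] at h5
  refine ⟨_, h5.mono ?_, fun hq => ?_, fun hq => ?_⟩
  · have hn := h.n_pos
    have hm := h.m_pos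
    -- The neighbourhood test is dominated by the filling of the matrix.
    have e1 : n * m ≤ m * n ^ 2 * Δ ^ 2 := by
      calc n * m = m * n * 1 := by ring
        _ ≤ m * n ^ 2 * Δ ^ 2 := by
          gcongr
          · exact Nat.le_self_pow (by omega) n
          · exact Nat.one_le_pow _ _ hΔ0
    have e2 : 1 ≤ n * m := Nat.mul_pos hn hm
    have e3 : 100 * (k + 1) * (n * m) + 1 ≤ 101 * (k + 1) ^ 2 * (m * n ^ 2 * Δ ^ 2) := by
      have : 1 ≤ (k + 1) * (n * m) := Nat.mul_pos (by omega) e2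
      calc 100 * (k + 1) * (n * m) + 1 ≤ 101 * ((k + 1) * (n * m)) := by linarith
        _ ≤ 101 * ((k + 1) ^ 2 * (m * n ^ 2 * Δ ^ 2)) := by
          gcongr
          exact Nat.le_self_pow (by omega) _
        _ = _ := by ring
    have e4 : (k + 2) * (36 * k + 110) * (m * n ^ k) ≤ 800 * (k + 1) ^ 2 * (m * n ^ k) := by
      refine Nat.mul_le_mul_right _ ?_
      nlinarith
    have e5 : 0 ≤ (k + 1) ^ 2 * (m * n ^ 2 * Δ ^ 2) := by positivity
    linarith
  · simp [State.of, h2, hq]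
  · simp [State.of, h2, hq]

end

end RAM

/-! ### Addresses of the edges in the encoding -/

/-- Where the lists in `L` begin if they stand one behind the other, each after its length. -/
def List.offset (L : List (List ℕ)) (j : ℕ) : ℕ :=
  ∑ i ∈ Finset.range j, ((L.getD i []).length + 1)

lemma List.offset_cons_succ (l : List ℕ) (L : List (List ℕ)) (j : ℕ) :
    List.offset (l :: L) (j + 1) = (l.length + 1) + List.offset L j := by
  rw [offset, Finset.sum_range_succ', add_comm]
  simp [offset]

lemma List.getD_flatMap_offset (L : List (List ℕ)) {j : ℕ} (hj : j < L.length) :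
    (L.flatMap fun l => l.length :: l).getD (L.offset j) 0 = (L.getD j []).length ∧
    ∀ i < (L.getD j []).length,
      (L.flatMap fun l => l.length :: l).getD (L.offset j + 1 + i) 0 = (L.getD j []).getD i 0 := by
  induction L generalizing j with
  | nil => simp at hj
  | cons l L ih =>
    rw [List.flatMap_cons]
    rcases j with _ | j
    · refine ⟨by simp [offset], fun i hi => ?_⟩
      have hi' : i < l.length := by simpa using hi
      rw [List.getD_append _ _ _ _ (by simp [offset]; omega)]
      simp [offset, add_comm 1 i]
    · obtain ⟨h1, h2⟩ := ih (j := j) (by simpa using hj)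
      refine ⟨?_, fun i hi => ?_⟩
      · rw [List.getD_append_right _ _ _ _ (by simp [offset_cons_succ]), offset_cons_succ]
        simpa using h1
      · rw [List.getD_append_right _ _ _ _ (by simp [offset_cons_succ]; omega), offset_cons_succ]
        have := h2 i (by simpa using hi)
        simp only [List.length_cons, List.getD_cons_succ]
        rw [← this]
        congr 1
        omega

/-! ### From a listing to a hypergraph on numbers -/

namespace Hypergraph

variable {α : Type u} {H : Hypergraph α}

namespace Listing

variable (R : H.Listing)

/-- the lists of the numbers of the vertices of the edges -/
def numbers : List (List ℕ) := R.edges.map fun l => l.map Fin.val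

/-- the list of the numbers of the vertices of an edge -/
def edge (j : ℕ) : List ℕ := R.numbers.getD j []

/-- the set of the vertices of an edge -/
def edgeSet (j : ℕ) : Set α := {x | ∃ i : Fin R.n, (i : ℕ) ∈ R.edge j ∧ R.vertex i = x}

variable {R}

lemma edge_eq {j : ℕ} (hj : j < R.edges.length) :
    R.edge j = (R.edges[j]).map Fin.val := by
  simp [edge, numbers, hj]

lemma mem_edge {j : ℕ} (hj : j < R.edges.length) {i : Fin R.n} :
    (i : ℕ) ∈ R.edge j ↔ i ∈ R.edges[j] := by
  rw [edge_eq hj, List.mem_map_of_injective Fin.val_injective]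

lemma lt_of_mem_edge {j : ℕ} (hj : j < R.edges.length) {x : ℕ} (hx : x ∈ R.edge j) : x < R.n := by
  rw [edge_eq hj, List.mem_map] at hx
  obtain ⟨i, -, rfl⟩ := hx
  exact i.2

lemma exists_mem_edge {j : ℕ} (hj : j < R.edges.length) {p : ℕ → Prop} :
    (∃ x ∈ R.edge j, p x) ↔ ∃ i : Fin R.n, (i : ℕ) ∈ R.edge j ∧ p i :=
  ⟨fun ⟨x, hx, hp⟩ => ⟨⟨x, lt_of_mem_edge hj hx⟩, hx, hp⟩, fun ⟨i, hi, hp⟩ => ⟨i, hi, hp⟩⟩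

lemma vertex_mem_edgeSet {j : ℕ} {i : Fin R.n} : R.vertex i ∈ R.edgeSet j ↔ (i : ℕ) ∈ R.edge j :=
  ⟨fun ⟨_, h, h'⟩ => R.vertex_injective h' ▸ h, fun h => ⟨i, h, rfl⟩⟩

lemma edgeSet_eq_image {j : ℕ} (hj : j < R.edges.length) :
    R.edgeSet j = R.vertex '' {i | i ∈ R.edges[j]} := by
  ext x
  simp [edgeSet, mem_edge hj]

lemma edgeSet_eq_image_Iio : H.edgeSet = R.edgeSet '' Set.Iio R.edges.length := by
  rw [R.edgeSet_eq]
  ext e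
  constructor
  · rintro ⟨l, hl, rfl⟩
    obtain ⟨j, hj, rfl⟩ := List.getElem_of_mem hl
    exact ⟨j, hj, edgeSet_eq_image hj⟩
  · rintro ⟨j, hj, rfl⟩
    exact ⟨_, List.getElem_mem hj, edgeSet_eq_image hj⟩

/-- Distinctness of the listed edges makes counting indices the same as counting edges, both for |E|
and for degrees. -/
lemma injOn_edgeSet : Set.InjOn R.edgeSet (Set.Iio R.edges.length) := by
  have key : ∀ i j (hj : j < R.edges.length), i < j → R.edgeSet i ≠ R.edgeSet j := by
    intro i j hj hij h
    rw [edgeSet_eq_image hj, edgeSet_eq_image (hij.trans hj)] at h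
    exact List.pairwise_iff_getElem.1 R.edges_distinct i j (hij.trans hj) hj hij
      (R.vertex_injective.image_injective h)
  intro i hi j hj h
  rcases lt_trichotomy i j with hij | hij | hij
  exacts [(key i j hj hij h).elim, hij, (key j i hi hij h.symm).elim]

lemma exists_mem_edgeSet {p : Set α → Prop} :
    (∃ e ∈ H.edgeSet, p e) ↔ ∃ j < R.edges.length, p (R.edgeSet j) := by
  rw [R.edgeSet_eq_image_Iio]
  simp

lemma forall_mem_edgeSet {p : Set α → Prop} :
    (∀ e ∈ H.edgeSet, p e) ↔ ∀ j < R.edges.length, p (R.edgeSet j) := by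
  rw [R.edgeSet_eq_image_Iio]
  simp

lemma ncard_vertexSet : H.vertexSet.ncard = R.n := by
  rw [← R.range_vertex, ← Set.image_univ, Set.ncard_image_of_injective _ R.vertex_injective]
  simp

lemma finite_vertexSet (R : H.Listing) : H.vertexSet.Finite := by
  rw [← R.range_vertex]
  exact Set.finite_range _

lemma finite_edgeSet (R : H.Listing) : H.edgeSet.Finite := by
  rw [R.edgeSet_eq_image_Iio]
  exact (Set.finite_Iio _).image _

lemma ncard_edgeSet : H.edgeSet.ncard = R.edges.length := by
  rw [R.edgeSet_eq_image_Iio, injOn_edgeSet.ncard_image]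
  simp

lemma length_edge_le {k : ℕ} (hk : H.dimension ≤ k) {j : ℕ} (hj : j < R.edges.length) :
    (R.edge j).length ≤ k := by
  refine le_trans ?_ hk
  have h1 : (R.edge j).length = (R.edgeSet j).ncard := by
    rw [edgeSet_eq_image hj, Set.ncard_image_of_injective _ R.vertex_injective, edge_eq hj,
      List.length_map, ← List.toFinset_card_of_nodup (R.nodup_of_mem _ (List.getElem_mem hj)),
      ← Set.ncard_coe_finset]
    simp
  rw [h1]
  refine le_csSup (R.finite_edgeSet.image _).bddAbove (Set.mem_image_of_mem _ ?_)
  rw [R.edgeSet_eq_image_Iio]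
  exact ⟨j, hj, rfl⟩

lemma degree_le_maxDegree (R : H.Listing) {v : α} (hv : v ∈ H.vertexSet) :
    H.degree v ≤ H.maxDegree :=
  le_csSup (R.finite_vertexSet.image _).bddAbove (Set.mem_image_of_mem _ hv)

lemma vertex_mem (R : H.Listing) (i : Fin R.n) : R.vertex i ∈ H.vertexSet :=
  R.range_vertex ▸ Set.mem_range_self i

lemma exists_vertex (R : H.Listing) {v : α} (hv : v ∈ H.vertexSet) : ∃ i, R.vertex i = v := by
  rwa [← R.range_vertex] at hv

lemma card_filter_le_maxDegree {x : ℕ} (hx : x < R.n) :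
    ((Finset.range R.edges.length).filter fun j => x ∈ R.edge j).card ≤ H.maxDegree := by
  refine le_trans ?_ (R.degree_le_maxDegree (R.vertex_mem ⟨x, hx⟩))
  have hinj : Set.InjOn R.edgeSet
      ((Finset.range R.edges.length).filter fun j => x ∈ R.edge j : Finset ℕ) :=
    injOn_edgeSet.mono fun j hj => by
      simp only [Finset.coe_filter, Finset.mem_range, Set.mem_ofPred_eq] at hj
      exact hj.1
  rw [← Set.ncard_coe_finset, ← hinj.ncard_image]
  refine Set.ncard_le_ncard ?_ (R.finite_edgeSet.subset fun e he => he.1)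
  rintro _ ⟨j, hj, rfl⟩
  simp only [Finset.coe_filter, Finset.mem_range, Set.mem_ofPred_eq] at hj
  refine ⟨?_, (vertex_mem_edgeSet (i := ⟨x, hx⟩)).2 hj.2⟩
  rw [R.edgeSet_eq_image_Iio]
  exact ⟨j, hj.1, rfl⟩

lemma dualAdj_iff {u v : Fin R.n} :
    H.DualAdj (R.vertex u) (R.vertex v) ↔ RAM.DualAdj R.edges.length R.edge u v := by
  rw [Hypergraph.dualAdj_iff R.finite_vertexSet]
  simp only [R.exists_mem_edgeSet, R.forall_mem_edgeSet, vertex_mem_edgeSet, RAM.DualAdj]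
  have key : ∀ e f g, g < R.edges.length →
      ((∃ x ∈ R.edgeSet g, ¬ (x ∈ R.edgeSet e ∧ x ≠ R.vertex u) ∧
        ¬ (x ∈ R.edgeSet f ∧ x ≠ R.vertex v)) ↔
      ∃ x ∈ R.edge g, ¬ (x ∈ R.edge e ∧ x ≠ u) ∧ ¬ (x ∈ R.edge f ∧ x ≠ v)) := by
    intro e f g hg
    rw [exists_mem_edge hg]
    constructor
    · rintro ⟨_, ⟨i, hi, rfl⟩, h⟩
      refine ⟨i, hi, ?_⟩
      simpa only [vertex_mem_edgeSet, R.vertex_injective.ne_iff, Ne, Fin.ext_iff,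
        R.vertex_injective.eq_iff] using h
    · rintro ⟨i, hi, h⟩
      refine ⟨_, ⟨i, hi, rfl⟩, ?_⟩
      simpa only [vertex_mem_edgeSet, R.vertex_injective.ne_iff, Ne, Fin.ext_iff,
        R.vertex_injective.eq_iff] using h
  refine exists_congr fun e => and_congr_right fun _ => and_congr_right fun _ =>
    exists_congr fun f => and_congr_right fun _ => and_congr_right fun _ => ?_
  exact forall₂_congr fun g hg => key e f g hg

/-- Choosing one obstructing vertex of D for each element of e gives y, and the values of y form a
clique again. Repetitions are allowed, as one vertex may obstruct several elements. -/
lemma exists_clique_iff {e : ℕ} (he : e < R.edges.length) :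
    (∃ D ⊆ H.vertexSet, (∀ x ∈ D, ∀ y ∈ D, x ≠ y → H.DualAdj x y) ∧
      ∀ x ∈ R.edgeSet e, ∃ y ∈ D, y ≠ x ∧ ¬ H.DualAdj x y) ↔
    ∃ y : ℕ → ℕ, ∀ j < (R.edge e).length,
      RAM.Obstructs R.n (RAM.DualAdj R.edges.length R.edge) (R.edge e) y j := by
  have hget : ∀ j < (R.edge e).length, (R.edge e).getD j 0 ∈ R.edge e := fun j hj => by
    rw [List.getD_eq_getElem _ _ hj]
    exact List.getElem_mem hj
  constructor
  · rintro ⟨D, hD, hclq, hobs⟩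
    -- The bound on j stands inside the existential so that the choice gives a total function, with
    -- value 0 allowed beyond the edge.
    have : ∀ j, ∃ y, j < (R.edge e).length → ∃ (hy : y < R.n) (hx : (R.edge e).getD j 0 < R.n),
        R.vertex ⟨y, hy⟩ ∈ D ∧ y ≠ (R.edge e).getD j 0 ∧
        ¬ H.DualAdj (R.vertex ⟨_, hx⟩) (R.vertex ⟨y, hy⟩) := by
      intro j
      by_cases hj : j < (R.edge e).length
      · have hx := lt_of_mem_edge he (hget j hj)
        obtain ⟨_, hy, hne, hadj⟩ := hobs (R.vertex ⟨_, hx⟩) (vertex_mem_edgeSet.2 (hget j hj))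
        obtain ⟨i, rfl⟩ := R.exists_vertex (hD hy)
        exact ⟨i, fun _ => ⟨i.2, hx, hy, fun h => hne (congrArg _ (Fin.ext h)), hadj⟩⟩
      · exact ⟨0, fun h => absurd h hj⟩
    choose y hy using this
    refine ⟨y, fun j hj => ?_⟩
    obtain ⟨h1, h2, h3, h4, h5⟩ := hy j hj
    refine ⟨h1, h4, fun h => h5 (dualAdj_iff.2 h), fun l hl => ?_⟩
    obtain ⟨g1, -, g3, -, -⟩ := hy l (hl.trans hj)
    by_cases hlj : y l = y j
    · exact .inl hlj
    · exact .inr (dualAdj_iff.1 (hclq _ g3 _ h3 fun h =>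
        hlj (Fin.ext_iff.1 (R.vertex_injective h))))
  · rintro ⟨y, hy⟩
    refine ⟨{x | ∃ (j : ℕ) (hj : j < (R.edge e).length), R.vertex ⟨y j, (hy j hj).1⟩ = x},
      ?_, ?_, ?_⟩
    · rintro _ ⟨j, hj, rfl⟩
      exact R.vertex_mem _
    -- Adjacency is known only towards earlier choices; symmetry gives the rest.
    · have key : ∀ j (hj : j < (R.edge e).length) l (hl : l < (R.edge e).length), l < j →
          R.vertex ⟨y l, (hy l hl).1⟩ ≠ R.vertex ⟨y j, (hy j hj).1⟩ →
          H.DualAdj (R.vertex ⟨y l, (hy l hl).1⟩) (R.vertex ⟨y j, (hy j hj).1⟩) := by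
        intro j hj l hl hlj hne
        rcases (hy j hj).2.2.2 l hlj with h | h
        · exact absurd (congrArg _ (Fin.ext h)) hne
        · exact dualAdj_iff.2 h
      rintro _ ⟨j, hj, rfl⟩ _ ⟨l, hl, rfl⟩ hne
      rcases lt_trichotomy j l with h | rfl | h
      exacts [(key _ hl _ hj h hne), absurd rfl hne, (key _ hj _ hl h hne.symm).symm]
    · rintro _ ⟨i, hi, rfl⟩
      obtain ⟨j, hj, hji⟩ := List.getElem_of_mem hi
      obtain ⟨h1, h2, h3, -⟩ := hy j hj
      rw [List.getD_eq_getElem _ _ hj, hji] at h2 h3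
      exact ⟨_, ⟨j, hj, rfl⟩, fun h => h2 (Fin.ext_iff.1 (R.vertex_injective h)),
        fun h => h3 (dualAdj_iff.1 h)⟩

lemma duallyConformal_iff (R : H.Listing) :
    RAM.DuallyConformal R.n R.edges.length R.edge ↔ H.IsDuallyConformal := by
  rw [isDuallyConformal_iff R.finite_vertexSet, R.forall_mem_edgeSet, RAM.DuallyConformal]
  refine and_congr ?_ ?_
  · push Not
    refine forall₂_congr fun e he => ?_
    have := not_congr (exists_clique_iff he)
    push Not at this
    exact this.symm
  · constructor
    · intro h v hv
      obtain ⟨i, rfl⟩ := R.exists_vertex hv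
      obtain ⟨e, he, h⟩ := h i i.2
      rw [R.exists_mem_edgeSet]
      refine ⟨e, he, ?_⟩
      rintro _ ⟨l, hl, rfl⟩
      rw [dualAdj_iff]
      exact h l hl
    · intro h v hv
      obtain ⟨e, he, h⟩ := R.exists_mem_edgeSet.1 (h _ (R.vertex_mem ⟨v, hv⟩))
      refine ⟨e, he, fun x hx => ?_⟩
      have := h (R.vertex ⟨x, lt_of_mem_edge he hx⟩) (vertex_mem_edgeSet.2 hx)
      rwa [dualAdj_iff] at this

lemma encode_eq (R : H.Listing) :
    R.encode = R.n :: R.edges.length :: R.numbers.flatMap fun l => l.length :: l := by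
  have h (l : List (Fin R.n)) : l.flatMap (fun a => [Fin.val a]) = l.map Fin.val :=
    List.map_eq_flatMap.symm
  simp [encode, numbers, List.flatMap_map, Function.comp_def, h]

lemma input {k W : ℕ} (hk : H.dimension ≤ k) (hn : 0 < R.n) (hm : 0 < R.edges.length)
    (hW : 2 + R.edges.length * (k + 1) + R.n * R.n + k + 2 < W) :
    RAM.Input W k R.n R.edges.length R.edge (fun j => 2 + R.numbers.offset j)
      (fun i => R.encode.getD i 0) := by
  have hlen : R.numbers.length = R.edges.length := by simp [numbers]
  refine ⟨hn, hm, hW, by simp [encode_eq], by simp [encode_eq], by simp [List.offset],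
    fun j hj => ?_, fun j hj => ?_, fun j hj i hi => ?_, fun j hj => length_edge_le hk hj,
    fun j hj x hx => lt_of_mem_edge hj hx⟩
  · simp only [List.offset, Finset.sum_range_succ, edge]
    omega
  · have := (R.numbers.getD_flatMap_offset (hlen ▸ hj)).1
    simp only [encode_eq, add_comm 2, List.getD_cons_succ]
    exact this
  · have := (R.numbers.getD_flatMap_offset (hlen ▸ hj)).2 i hi
    have e : 2 + R.numbers.offset j + 1 + i = R.numbers.offset j + 1 + i + 1 + 1 := by omega
    simp only [encode_eq, e, List.getD_cons_succ]
    exact this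

lemma lt_of_mem_encode {k W : ℕ} (hk : H.dimension ≤ k)
    (hn : R.n < W) (hm : R.edges.length < W) (hkW : k < W) {a : ℕ} (ha : a ∈ R.encode) :
    a < W := by
  simp only [encode_eq, List.mem_cons, List.mem_flatMap] at ha
  rcases ha with rfl | rfl | ⟨l, hl, ha⟩
  · exact hn
  · exact hm
  · obtain ⟨j, hj, rfl⟩ := List.getElem_of_mem hl
    have hj' : j < R.edges.length := by simpa [numbers] using hj
    have he : R.numbers[j] = R.edge j := by rw [edge, List.getD_eq_getElem]
    rw [he] at ha
    rcases ha with rfl | ha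
    · exact (length_edge_le hk hj').trans_lt hkW
    · exact (lt_of_mem_edge hj' ha).trans hn

end Listing

end Hypergraph

/-! ### Word size and conclusion -/

/-- With b = n + m ≥ 2, the factor b^k ≥ k + 1 absorbs the dependence on k, and 4 + b + b² < b⁴ does
the rest. -/
lemma word_lt_pow (k : ℕ) {n m : ℕ} (hn : 0 < n) (hm : 0 < m) :
    2 + m * (k + 1) + n * n + k + 2 < (n + m) ^ (k + 4) := by
  have hb : 2 ≤ n + m := by omega
  have h1 : k + 1 ≤ (n + m) ^ k := Nat.lt_two_pow_self.trans_le (Nat.pow_le_pow_left hb k)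
  have h2 : m * (k + 1) ≤ (n + m) * (n + m) ^ k := by gcongr; omega
  have h3 : n * n ≤ (n + m) ^ 2 * (n + m) ^ k :=
    calc n * n ≤ (n + m) ^ 2 * 1 := by nlinarith
      _ ≤ _ := by gcongr; omega
  have h4 : (n + m) ^ (k + 4) = (n + m) ^ 4 * (n + m) ^ k := by ring
  have h5 : 3 + (n + m) + (n + m) ^ 2 + 1 < (n + m) ^ 4 := by
    have e1 : 4 ≤ (n + m) ^ 2 := by nlinarith
    have e2 : (n + m) ^ 4 = (n + m) ^ 2 * (n + m) ^ 2 := by ring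
    nlinarith
  calc 2 + m * (k + 1) + n * n + k + 2
      ≤ (n + m) * (n + m) ^ k + (n + m) ^ 2 * (n + m) ^ k + 4 * (n + m) ^ k := by linarith
    _ = (3 + (n + m) + (n + m) ^ 2 + 1) * (n + m) ^ k := by ring
    _ < (n + m) ^ 4 * (n + m) ^ k := by gcongr
    _ = _ := h4.symm

/-- For every positive integer `k` there is a program that decides dual conformality of
hypergraphs `H = (V, E)` of dimension at most `k` and maximum degree `Δ` in time
`O(|E| |V|² Δ² + |E| |V|^k)`, on a random access machine with words of `O(log (|V| + |E|))` bits;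
the implied constants depend only on `k`. -/
theorem mainTheorem1 (k : ℕ) (hk : 0 < k) :
    ∃ (P : RAM.Program) (C w : ℕ),
      ∀ (α : Type u) (H : Hypergraph α) (R : H.Listing),
        H.vertexSet.Nonempty →
        (∀ v ∈ H.vertexSet, ∃ e ∈ H.edgeSet, v ∈ e) →
        H.dimension ≤ k →
        RAM.Answers ((H.vertexSet.ncard + H.edgeSet.ncard) ^ w) P R.encode
          (C * (H.edgeSet.ncard * H.vertexSet.ncard ^ 2 * H.maxDegree ^ 2 +
            H.edgeSet.ncard * H.vertexSet.ncard ^ k))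
          H.IsDuallyConformal := by
  refine ⟨RAM.procedure k, 800 * (k + 1) ^ 2, k + 4, fun α H R hV hcov hdim => ?_⟩
  rw [R.ncard_vertexSet, R.ncard_edgeSet]
  obtain ⟨v, hv⟩ := hV
  obtain ⟨e, he, hve⟩ := hcov v hv
  have hn : 0 < R.n := by
    obtain ⟨i, -⟩ := R.exists_vertex hv
    exact i.pos
  have hm : 0 < R.edges.length := by
    rw [← R.ncard_edgeSet, Set.ncard_pos R.finite_edgeSet]
    exact ⟨e, he⟩
  -- Δ ≥ 1 because v is covered by an edge; otherwise the first term of the bound would vanish and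
  -- could not pay for the scans.
  have hΔ : 0 < H.maxDegree := by
    refine lt_of_lt_of_le ?_ (R.degree_le_maxDegree hv)
    rw [Hypergraph.degree, Set.ncard_pos (R.finite_edgeSet.subset fun e he => he.1)]
    exact ⟨e, he, hve⟩
  have hW := word_lt_pow k hn hm
  have hin := R.input hdim hn hm hW
  refine ⟨fun a ha => R.lt_of_mem_encode hdim hin.n_lt hin.m_lt (by omega) ha, ?_⟩
  obtain ⟨s, ⟨t, ht, hs⟩, h1, h2⟩ := RAM.runs_procedure hin hΔ
    fun x hx => R.card_filter_le_maxDegree hx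
  rw [R.duallyConformal_iff] at h1 h2
  exact ⟨s, t, hs, ht, h1, h2⟩
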